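/- Let $n$ be even, let $y\in\{\pm1\}^n$ satisfy $\sum_{i=1}^n y_i=0$, let $\sigma\ge 0$, and let $\mathbf W\in(\mathbb R^n)^{\otimes 4}$ have independent standard Gaussian entries. Put $\mathbf T=y^{\otimes4}+\sigma\mathbf W$ and $f(x)=\langle \mathbf T,x^{\otimes 4}\rangle$ for $x\in\{\pm1\}^n$. Every real function on $\{\pm1\}^n$ is a unique linear combination of the monomials $x_S=\prod_{i\in S}x_i$, $S\subseteq[n]$; its degree is the largest $|S|$ that occurs. A pseudo-expectation of degree $4$ on $\{\pm1\}^n$ is a linear functional $\widetilde{\mathbb E}$ on the real functions on $\{\pm1\}^n$ with $\widetilde{\mathbb E}[1]=1$ and $\widetilde{\mathbb E}[q^2]\ge0$ for every $q$ of degree at most $2$. It satisfies $\sum_i x_i=0$ if $\widetilde{\mathbb E}\big[(\sum_i x_i)\,q\big]=0$ for every function $q$ such that $(\sum_i x_i)\,q$ has degree at most $4$. The degree-4 SoS relaxation is the problem of maximizing $\widetilde{\mathbb E}[f]$ over all pseudo-expectations of degree $4$ satisfying $\sum_i x_i=0$. Let $\mathbb E_{U(\{y,-y\})}$ denote the expectation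 over the uniform distribution on $\{y,-y\}$. **(1)** There is an absolute constant $C>0$ such that, if $0\le\sigma\le C\,n/\sqrt{\log n}$, then with probability $1-o_n(1)$ the relaxation is maximized by $\mathbb E_{U(\{y,-y\})}$; moreover the maximizer is unique up to odd moments, i.e. every maximizer $\widetilde{\mathbb E}$ satisfies $\widetilde{\mathbb E}[x_S]=\mathbb E_{U(\{y,-y\})}[x_S]=y_S$, where $y_S=\prod_{i\in S}y_i$, for all $S\subseteq [n]$ with $|S|\in\{0,2,4\}$. **(2)** For every constant $c>0$, if $\sigma\ge n(\log n)^{1/2+c}$, then with probability $1-o_n(1)$ there exists a pseudo-expectation $\widetilde{\mathbb E}$ of degree $4$ on $\{\pm1\}^n$ satisfying $\sum_i x_i=0$ (and depending on $\mathbf W$) with $\widetilde{\mathbb E}[f]>f(y)$; thus $\mathbb E_{U(\{y,-y\})}$ is not optimal. In both parts the $o_n(1)$ is uniform in $y$ and in $\sigma$ within the stated range; in (2) it may depend on $c$. -/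

import Mathlib

open MeasureTheory ProbabilityTheory Filter

namespace SpikedTensor

/-- The hypercube `{±1}ⁿ`. -/
abbrev Cube (n : ℕ) : Type := Fin n → ℤˣ

/-- Real-valued functions on the hypercube. -/
abbrev CubeFun (n : ℕ) : Type := Cube n → ℝ

/-- The coordinate function `xᵢ` on the hypercube, with real values. -/
def coord {n : ℕ} (i : Fin n) : CubeFun n := fun x => ((x i : ℤ) : ℝ)

/-- The multilinear monomial `x_S = ∏_{i ∈ S} xᵢ`. -/
def mono {n : ℕ} (S : Finset (Fin n)) : CubeFun n := ∏ i ∈ S, coord i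

/-- The functions on the hypercube of degree at most `d`: the linear combinations of the
monomials `x_S` with `|S| ≤ d`. -/
def degLE (n d : ℕ) : Submodule ℝ (CubeFun n) :=
  Submodule.span ℝ {f | ∃ S : Finset (Fin n), S.card ≤ d ∧ f = mono S}

/-- `E` is a pseudo-expectation of degree `2 * l` on the hypercube. -/
structure IsPseudoExpectation {n : ℕ} (l : ℕ) (E : CubeFun n →ₗ[ℝ] ℝ) : Prop where
  map_one : E 1 = 1
  sq_nonneg : ∀ q ∈ degLE n l, 0 ≤ E (q * q)

/-- `E`, as a functional of degree `d`, satisfies the equation `p = 0`: it vanishes on every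
function of degree at most `d` that is a multiple of `p`. -/
def SatisfiesEq {n : ℕ} (d : ℕ) (E : CubeFun n →ₗ[ℝ] ℝ) (p : CubeFun n) : Prop :=
  ∀ q : CubeFun n, p * q ∈ degLE n d → E (p * q) = 0

/-- The feasible set of the degree-4 relaxation: pseudo-expectations of degree 4 on the
hypercube that satisfy `∑ i, xᵢ = 0`. -/
def feasible (n : ℕ) : Set (CubeFun n →ₗ[ℝ] ℝ) :=
  {E | IsPseudoExpectation 2 E ∧ SatisfiesEq 4 E (∑ i, coord i)}

/-- Real tensors of order 4 and dimension `n`. -/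
abbrev Tensor (n : ℕ) : Type := (Fin 4 → Fin n) → ℝ

/-- The tensor power `x^{⊗4}`. -/
def tensorPow {n : ℕ} (x : Cube n) : Tensor n := fun a => ∏ s, coord (a s) x

/-- The spiked tensor `T = y^{⊗4} + σ W`. -/
noncomputable def spiked {n : ℕ} (y : Cube n) (σ : ℝ) (W : Tensor n) : Tensor n :=
  tensorPow y + σ • W

/-- The objective `x ↦ ⟨T, x^{⊗4}⟩`. -/
noncomputable def objective {n : ℕ} (T : Tensor n) : CubeFun n :=
  fun x => ∑ a, T a * tensorPow x a

/-- The expectation functional of the uniform distribution on `{y, -y}`. -/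
noncomputable def unifPair {n : ℕ} (y : Cube n) : CubeFun n →ₗ[ℝ] ℝ :=
  (1 / 2 : ℝ) • ((LinearMap.proj y : CubeFun n →ₗ[ℝ] ℝ) + LinearMap.proj (-y))

/-- The law of a tensor with independent standard Gaussian entries. -/
noncomputable def gaussianTensor (n : ℕ) : Measure (Tensor n) :=
  Measure.pi fun _ => gaussianReal 0 1

/-- The relaxation with objective `f` recovers `y` up to a global sign: the expectation over
the uniform distribution on `{y, -y}` is feasible and maximal, and every maximizer has the same
moments of even degree at most 4. -/
def Recovers {n : ℕ} (f : CubeFun n) (y : Cube n) : Prop :=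
  unifPair y ∈ feasible n ∧
  (∀ E ∈ feasible n, E f ≤ unifPair y f) ∧
  (∀ E ∈ feasible n, E f = unifPair y f →
    ∀ S : Finset (Fin n), S.card ≤ 4 → Even S.card → E (mono S) = unifPair y (mono S))

end SpikedTensor

/-! Part (1) is a spectral gap argument. Read the tensor as a matrix indexed by pairs p = (i, j) and
twist by the signs of y: with X_p = y_i y_j x_i x_j one has f(x) = ∑ (1 + σ w_pq) X_p X_q, where w
is the noise up to signs, and y corresponds to the all-ones vector. Since X_p² = 1, the deficit f(y)
- f(x) is the Laplacian form of the complete graph on n² vertices with noisy weights. In the centred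
variables Y_p it equals ∑ (n² + σ (row_p + col_p) / 2) Y_p² - σ ∑ w_pq Y_p Y_q. With high
probability the row and column sums are at least -O(n √log n) and the quadratic form of w is at most
O(n) times the squared norm, so a degree-4 pseudo-expectation loses at least (n² - O(σ n √log n)) ∑
E[Y_p²] (`value_add_le`). The bracket is positive below the threshold, and zero loss makes every
pseudo-variance vanish, which fixes the even moments (`map_signedPair_mul_eq_one`).

Part (2) builds a competitor from the noise. Index the coordinates by (j, ±) and substitute x_(j,±)
= ± z_j, so that ∑ x_i = 0 holds identically. On the cube of z, tilt the uniform distribution by the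
density 1 + γ ∑_{|S|=4} g_S z_S, where the g_S are the Fourier coefficients of the folded noise. The
noise form on polynomials of degree at most 2 has norm O(n), so γ of order 1/n keeps squares
nonnegative (`noiseExp_feasible`), while the noise gains γ ∑ g_S², of order n³
(`noiseExp_objective_noise`). The signal polynomial is a square, so its value stays nonnegative,
against n⁴ at y; the remaining linear term in W is O(n²). Hence σ above a large multiple of n
already suffices, and the power of log n is only used to exceed that constant.

Both norm bounds come from one net argument, `gaussian_bilin_bound`. -/

namespace SpikedTensor

/-! ### Linear forms in independent Gaussians -/

section Gaussian

variable {I : Type*} [Fintype I]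

/-- The standard Gaussian measure on `I → ℝ`. -/
noncomputable abbrev stdGauss (I : Type*) [Fintype I] : Measure (I → ℝ) :=
  Measure.pi fun _ => gaussianReal 0 1

theorem hasGaussianLaw_eval (a : I) :
    HasGaussianLaw (fun W : I → ℝ => W a) (stdGauss I) := by
  have h : HasLaw (fun W : I → ℝ => W a) (gaussianReal 0 1) (stdGauss I) :=
    ⟨(measurable_pi_apply a).aemeasurable,
      (measurePreserving_eval (fun _ : I => gaussianReal 0 1) a).map_eq⟩
  exact h.hasGaussianLaw

theorem iIndepFun_eval : iIndepFun (fun (a : I) (W : I → ℝ) => W a) (stdGauss I) :=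
  iIndepFun_pi (X := fun _ x => x) fun _ => aemeasurable_id

theorem variance_linear (t : I → ℝ) :
    Var[fun W : I → ℝ => ∑ a, t a * W a; stdGauss I] = ∑ a, t a ^ 2 := by
  have h := variance_sum_pi (μ := fun _ : I => gaussianReal 0 1) (X := fun a x => t a * x)
    (fun a => (memLp_id_gaussianReal 2).const_mul (t a))
  have e : (∑ a, fun W : I → ℝ => t a * W a) = fun W : I → ℝ => ∑ a, t a * W a := by
    ext W; simp
  rw [e] at h
  rw [h]
  refine Finset.sum_congr rfl fun a _ => ?_
  rw [variance_const_mul, variance_fun_id_gaussianReal]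
  simp

theorem integral_linear (t : I → ℝ) :
    ∫ W : I → ℝ, ∑ a, t a * W a ∂stdGauss I = 0 := by
  rw [integral_finsetSum _ fun a _ => (hasGaussianLaw_eval a).integrable.const_mul (t a)]
  refine Finset.sum_eq_zero fun a _ => ?_
  rw [integral_const_mul]
  have := (measurePreserving_eval (fun _ : I => gaussianReal 0 1) a).map_eq
  have h2 := integral_map (μ := stdGauss I) (φ := fun W : I → ℝ => W a) (f := fun x : ℝ => x)
    (measurable_pi_apply a).aemeasurable aestronglyMeasurable_id
  rw [← h2]
  change t a * ∫ y, y ∂Measure.map (Function.eval a) (stdGauss I) = 0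
  rw [this, integral_id_gaussianReal, mul_zero]

theorem map_linear (t : I → ℝ) :
    (stdGauss I).map (fun W : I → ℝ => ∑ a, t a * W a) =
      gaussianReal 0 (∑ a, t a ^ 2).toNNReal := by
  have h : HasGaussianLaw (fun (W : I → ℝ) a => W a) (stdGauss I) :=
    iIndepFun.hasGaussianLaw hasGaussianLaw_eval iIndepFun_eval
  have h3 : HasGaussianLaw (fun W : I → ℝ => ∑ a, t a * W a) (stdGauss I) := by
    have := h.map_fun (∑ a, t a • ContinuousLinearMap.proj (R := ℝ) (φ := fun _ : I => ℝ) a)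
    refine this.congr (ae_of_all _ fun W => ?_)
    simp
  rw [h3.map_eq_gaussianReal, variance_linear, integral_linear]

theorem measurable_linear (t : I → ℝ) : Measurable fun W : I → ℝ => ∑ a, t a * W a := by
  fun_prop

/-- Gaussian tail bound for a linear form. -/
theorem linear_tail (t : I → ℝ) {v τ : ℝ} (hv : 0 < v) (ht : ∑ a, t a ^ 2 ≤ v) (hτ : 0 ≤ τ) :
    stdGauss I {W | τ ≤ ∑ a, t a * W a} ≤ ENNReal.ofReal (Real.exp (-τ ^ 2 / (2 * v))) := by
  have h : HasSubgaussianMGF (fun W : I → ℝ => ∑ a, t a * W a) v.toNNReal (stdGauss I) := by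
    constructor
    · intro s
      have := integrable_exp_mul_gaussianReal (μ := 0) (v := (∑ a, t a ^ 2).toNNReal) s
      rw [← map_linear t] at this
      exact this.comp_measurable (measurable_linear t)
    · intro s
      rw [mgf_gaussianReal (map_linear t)]
      apply Real.exp_le_exp.2
      rw [Real.coe_toNNReal _ hv.le, Real.coe_toNNReal _ (Finset.sum_nonneg fun _ _ => sq_nonneg _)]
      have := mul_le_mul_of_nonneg_right ht (sq_nonneg s)
      linarith
  have := h.measure_ge_le hτ
  rw [Real.coe_toNNReal _ hv.le] at this
  rw [← ofReal_measureReal]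
  exact ENNReal.ofReal_le_ofReal this

/-- Small ball bound for a linear form of variance at least one. -/
theorem linear_small_ball (t : I → ℝ) (ht : 1 ≤ ∑ a, t a ^ 2) :
    (stdGauss I).real {W | |∑ a, t a * W a| < 1 / 2} ≤ 1 / 2 := by
  set v : NNReal := (∑ a, t a ^ 2).toNNReal with hv
  have hv1 : 1 ≤ (v : ℝ) := by
    rw [hv, Real.coe_toNNReal _ (by linarith)]; exact ht
  have hv0 : v ≠ 0 := by
    rintro h; rw [h] at hv1; norm_num at hv1
  have hset : {W : I → ℝ | |∑ a, t a * W a| < 1 / 2} =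
      (fun W : I → ℝ => ∑ a, t a * W a) ⁻¹' Set.Ioo (-(1 / 2)) (1 / 2) := by
    ext W; simp [abs_lt]
  -- The density is at most 1 / √(2π) ≤ 1 / 2, and the interval has length 1.
  have hpdf : ∀ x, gaussianPDF 0 v x ≤ ENNReal.ofReal (1 / 2) := by
    intro x
    refine ENNReal.ofReal_le_ofReal ?_
    rw [gaussianPDFReal_def]
    have h4 : (2 : ℝ) ≤ √(2 * Real.pi * v) := by
      apply Real.le_sqrt_of_sq_le
      nlinarith [Real.pi_gt_three]
    have h5 : (√(2 * Real.pi * v))⁻¹ ≤ 1 / 2 := by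
      rw [one_div]; exact inv_anti₀ (by norm_num) h4
    have h6 : Real.exp (-(x - 0) ^ 2 / (2 * v)) ≤ 1 := by
      apply Real.exp_le_one_iff.2
      apply div_nonpos_of_nonpos_of_nonneg
      · nlinarith [sq_nonneg (x - 0)]
      · positivity
    calc _ ≤ 1 / 2 * 1 := mul_le_mul h5 h6 (Real.exp_pos _).le (by norm_num)
      _ = 1 / 2 := by norm_num
  have hm : stdGauss I {W | |∑ a, t a * W a| < 1 / 2} ≤ ENNReal.ofReal (1 / 2) := by
    rw [hset, ← Measure.map_apply (measurable_linear t) measurableSet_Ioo, map_linear,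
      gaussianReal_apply _ hv0]
    calc _ ≤ ∫⁻ x in Set.Ioo (-(1 / 2 : ℝ)) (1 / 2), ENNReal.ofReal (1 / 2) :=
          lintegral_mono hpdf
      _ = _ := by
          rw [setLIntegral_const, Real.volume_Ioo]; norm_num
  exact ENNReal.toReal_le_of_le_ofReal (by norm_num) hm

/-- Among sufficiently many linear forms with disjoint supports and variances at least one, a
quarter take values of size at least `1 / 2`, with high probability. -/
theorem sum_sq_linear_lower {κ : Type*} (s : Finset κ) (t : κ → I → ℝ)
    (ht : ∀ k ∈ s, 1 ≤ ∑ a, t k a ^ 2)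
    (hdis : ∀ k ∈ s, ∀ l ∈ s, k ≠ l → ∀ a, t k a = 0 ∨ t l a = 0) (hs : s.Nonempty) :
    stdGauss I {W | ∑ k ∈ s, (∑ a, t k a * W a) ^ 2 ≤ s.card / 16} ≤
      ENNReal.ofReal (16 / s.card) := by
  classical
  set μ := stdGauss I
  have hcard : (0 : ℝ) < s.card := by exact_mod_cast hs.card_pos
  -- Squares are replaced by the indicator of |x| ≥ 1/2, which is at most 4x². It is bounded, so
  -- Chebyshev applies without any upper bound on the variances of the forms.
  let A : Set ℝ := {x | 1 / 2 ≤ |x|}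
  have hA : MeasurableSet A := measurableSet_le measurable_const measurable_id.abs
  let φ : ℝ → ℝ := A.indicator 1
  have hφm : Measurable φ := measurable_one.indicator hA
  have hφ0 : ∀ x, 0 ≤ φ x := fun x => Set.indicator_nonneg (fun _ _ => zero_le_one) x
  have hφ1 : ∀ x, φ x ≤ 1 := fun x => Set.indicator_le_self' (fun _ _ => zero_le_one) x
  have hφsq : ∀ x, φ x ≤ 4 * x ^ 2 := by
    intro x
    by_cases hx : x ∈ A
    · have h1 : φ x = 1 := Set.indicator_of_mem hx _
      have h2 : (1 / 2 : ℝ) ≤ |x| := hx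
      rw [h1, ← sq_abs]; nlinarith
    · have h1 : φ x = 0 := Set.indicator_of_notMem hx _
      rw [h1]; positivity
  let Z : κ → (I → ℝ) → ℝ := fun k W => φ (∑ a, t k a * W a)
  have hZm : ∀ k, Measurable (Z k) := fun k => hφm.comp (measurable_linear _)
  have hLp : ∀ k, MemLp (Z k) 2 μ := fun k =>
    MemLp.of_bound (hZm k).aestronglyMeasurable 1
      (ae_of_all _ fun W => by rw [Real.norm_eq_abs, abs_of_nonneg (hφ0 _)]; exact hφ1 _)
  have hmean : ∀ k ∈ s, 1 / 2 ≤ ∫ W, Z k W ∂μ := by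
    intro k hk
    have hset : MeasurableSet {W : I → ℝ | |∑ a, t k a * W a| < 1 / 2} :=
      measurableSet_lt (measurable_linear _).abs measurable_const
    have h1 : Z k = {W : I → ℝ | |∑ a, t k a * W a| < 1 / 2}ᶜ.indicator 1 := by
      ext W
      simp only [Z, φ, A, Set.indicator_apply, Set.mem_ofPred_eq, Set.mem_compl_iff, not_lt]
      rfl
    rw [h1, integral_indicator_one hset.compl, probReal_compl_eq_one_sub hset]
    linarith [linear_small_ball (t k) (ht k hk)]
  have hvar : ∀ k, Var[Z k; μ] ≤ 1 := by
    intro k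
    refine (variance_le_expectation_sq (hZm k).aestronglyMeasurable).trans ?_
    calc _ ≤ ∫ W, (1 : ℝ) ∂μ := by
          refine integral_mono_of_nonneg (ae_of_all _ fun W => sq_nonneg _)
            (integrable_const _) (ae_of_all _ fun W => ?_)
          change (Z k W) ^ 2 ≤ 1
          have := hφ0 (∑ a, t k a * W a); have := hφ1 (∑ a, t k a * W a)
          change φ _ ^ 2 ≤ 1
          nlinarith
      _ = 1 := by simp
  have hind : (s : Set κ).Pairwise fun k l => IndepFun (Z k) (Z l) μ := by
    intro k hk l hl hkl
    let S := Finset.univ.filter fun a => t k a ≠ 0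
    let T := Finset.univ.filter fun a => t l a ≠ 0
    have hST : Disjoint S T := by
      rw [Finset.disjoint_left]
      intro a ha hb
      rcases hdis k hk l hl hkl a with h | h
      · exact (Finset.mem_filter.1 ha).2 h
      · exact (Finset.mem_filter.1 hb).2 h
    have h := iIndepFun.indepFun_finset S T hST (iIndepFun_eval (I := I)) measurable_pi_apply
    have key : ∀ (k : κ) (S : Finset I), (∀ a, a ∉ S → t k a = 0) →
        Z k = (fun w : S → ℝ => φ (∑ a : S, t k a * w a)) ∘ fun W (i : S) => W i := by
      intro k S hS
      ext W
      simp only [Z, Function.comp]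
      congr 1
      rw [← Finset.sum_coe_sort S (fun a => t k a * W a) |>.symm]
      refine (Finset.sum_subset (Finset.subset_univ S) fun a _ ha => ?_).symm
      rw [hS a ha, zero_mul]
    rw [key k S (fun a ha => by simpa [S] using ha), key l T (fun a ha => by simpa [T] using ha)]
    exact h.comp (hφm.comp (by fun_prop)) (hφm.comp (by fun_prop))
  have hV : Var[∑ k ∈ s, Z k; μ] ≤ s.card := by
    rw [IndepFun.variance_sum (fun k _ => hLp k) hind]
    calc _ ≤ ∑ k ∈ s, (1 : ℝ) := Finset.sum_le_sum fun k _ => hvar k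
      _ = _ := by simp
  have hE : (s.card : ℝ) / 2 ≤ ∫ W, (∑ k ∈ s, Z k) W ∂μ := by
    simp only [Finset.sum_apply]
    rw [integral_finsetSum _ fun k _ => (hLp k).integrable (by norm_num)]
    calc (s.card : ℝ) / 2 = ∑ k ∈ s, (1 / 2 : ℝ) := by simp; ring
      _ ≤ _ := Finset.sum_le_sum hmean
  have hch := meas_ge_le_variance_div_sq (memLp_finsetSum' s fun k _ => hLp k)
    (show (0 : ℝ) < s.card / 4 by positivity)
  refine le_trans (measure_mono fun W hW => ?_) (hch.trans (ENNReal.ofReal_le_ofReal ?_))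
  · simp only [Set.mem_ofPred_eq] at hW ⊢
    have h1 : (∑ k ∈ s, Z k) W ≤ s.card / 4 := by
      rw [Finset.sum_apply]
      calc _ ≤ ∑ k ∈ s, 4 * (∑ a, t k a * W a) ^ 2 := Finset.sum_le_sum fun k _ => hφsq _
        _ = 4 * ∑ k ∈ s, (∑ a, t k a * W a) ^ 2 := by rw [Finset.mul_sum]
        _ ≤ _ := by linarith
    rw [abs_sub_comm]
    exact le_trans (by linarith) (le_abs_self _)
  · calc _ ≤ (s.card : ℝ) / (s.card / 4) ^ 2 := by gcongr
      _ = _ := by field_simp; norm_num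

end Gaussian

/-! ### Norm of a random bilinear form by a net -/

section Net

variable {ι : Type*} [Fintype ι]

/-- Truncation towards zero, instead of rounding, keeps the approximating grid point inside the unit
ball. -/
theorem exists_int_truncation (x : ℝ) : ∃ k : ℤ, |(k : ℝ)| ≤ |x| ∧ |x - k| ≤ 1 := by
  rcases le_total 0 x with hx | hx
  · refine ⟨⌊x⌋, ?_, ?_⟩
    · rw [abs_of_nonneg hx, abs_of_nonneg (by exact_mod_cast Int.floor_nonneg.2 hx)]
      exact Int.floor_le x
    · rw [abs_of_nonneg (sub_nonneg.2 (Int.floor_le x))]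
      linarith [Int.lt_floor_add_one x]
  · refine ⟨⌈x⌉, ?_, ?_⟩
    · have h : (⌈x⌉ : ℝ) ≤ 0 := by exact_mod_cast Int.ceil_le.2 (by simpa using hx)
      rw [abs_of_nonpos hx, abs_of_nonpos h]
      linarith [Int.le_ceil x]
    · rw [abs_of_nonpos (sub_nonpos.2 (Int.le_ceil x))]
      linarith [Int.ceil_lt_add_one x]

/-- The integer vectors of Euclidean norm at most `4 * r`. -/
def intGrid (ι : Type*) [Fintype ι] (r : ℕ) : Set (ι → ℤ) := {k | ∑ i, k i ^ 2 ≤ 16 * (r : ℤ) ^ 2}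

theorem continuous_bilin (b : (ι → ℝ) →ₗ[ℝ] (ι → ℝ) →ₗ[ℝ] ℝ) :
    Continuous fun p : (ι → ℝ) × (ι → ℝ) => b p.1 p.2 := by
  classical
  have h : ∀ p : (ι → ℝ) × (ι → ℝ), b p.1 p.2 =
      ∑ i, ∑ j, p.1 i * (p.2 j * b (Pi.single i 1) (Pi.single j 1)) := by
    intro p
    conv_lhs => rw [pi_eq_sum_univ' p.1, pi_eq_sum_univ' p.2]
    simp only [map_sum, LinearMap.sum_apply, map_smul, LinearMap.smul_apply, smul_eq_mul,
      Finset.mul_sum]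
    rw [Finset.sum_comm]
    exact Finset.sum_congr rfl fun _ _ => Finset.sum_congr rfl fun _ _ => by ring
  simp_rw [h]
  fun_prop

/-- A bilinear form is bounded by twice its maximum over pairs of points of a fine grid. -/
theorem bilin_le_of_grid (b : (ι → ℝ) →ₗ[ℝ] (ι → ℝ) →ₗ[ℝ] ℝ) {r : ℕ} (hr : 0 < r)
    (hι : Fintype.card ι ≤ r ^ 2) {t : ℝ}
    (h : ∀ k ∈ intGrid ι r, ∀ l ∈ intGrid ι r,
      b (fun i => k i / (4 * r)) (fun i => l i / (4 * r)) ≤ t) (u : ι → ℝ) :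
    |b u u| ≤ 2 * t * ∑ i, u i ^ 2 := by
  have hr' : (0 : ℝ) < r := by exact_mod_cast hr
  let K : Set (ι → ℝ) := {u | ∑ i, u i ^ 2 ≤ 1}
  have hK0 : (0 : ι → ℝ) ∈ K := by simp [K]
  have hKc : IsCompact K := by
    refine Metric.isCompact_of_isClosed_isBounded ?_ ?_
    · exact isClosed_le (by fun_prop) continuous_const
    · refine (Metric.isBounded_closedBall (x := (0 : ι → ℝ)) (r := 1)).subset fun u hu => ?_
      rw [mem_closedBall_zero_iff, pi_norm_le_iff_of_nonneg zero_le_one]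
      intro i
      rw [Real.norm_eq_abs, ← sq_le_one_iff_abs_le_one]
      exact (Finset.single_le_sum (f := fun i => u i ^ 2) (fun _ _ => sq_nonneg _)
        (Finset.mem_univ i)).trans hu
  obtain ⟨⟨u₀, v₀⟩, ⟨hu₀, hv₀⟩, hmax⟩ := (hKc.prod hKc).exists_isMaxOn ⟨(0, 0), hK0, hK0⟩
    (continuous_bilin b).continuousOn
  have hmax' : ∀ u ∈ K, ∀ v ∈ K, b u v ≤ b u₀ v₀ := fun u hu v hv =>
    isMaxOn_iff.1 hmax (u, v) ⟨hu, hv⟩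
  -- The grid has mesh 1 / (4r) and the dimension is at most r², so the Euclidean error is at most
  -- 1/4.
  have happ : ∀ u ∈ K, ∃ k ∈ intGrid ι r, (fun i => (k i : ℝ) / (4 * r)) ∈ K ∧
      (4 : ℝ) • (u - fun i => (k i : ℝ) / (4 * r)) ∈ K := by
    intro u hu
    choose k hk1 hk2 using fun i => exists_int_truncation (4 * r * u i)
    have h1 : ∑ i, (k i : ℝ) ^ 2 ≤ 16 * (r : ℝ) ^ 2 := by
      calc _ ≤ ∑ i, (4 * r * u i) ^ 2 := Finset.sum_le_sum fun i _ => sq_le_sq.2 (hk1 i)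
        _ = 16 * r ^ 2 * ∑ i, u i ^ 2 := by
          rw [Finset.mul_sum]; exact Finset.sum_congr rfl fun i _ => by ring
        _ ≤ 16 * r ^ 2 * 1 := by gcongr; exact hu
        _ = _ := by ring
    refine ⟨k, ?_, ?_, ?_⟩
    · change ∑ i, k i ^ 2 ≤ 16 * (r : ℤ) ^ 2
      exact_mod_cast h1
    · change ∑ i, ((k i : ℝ) / (4 * r)) ^ 2 ≤ 1
      simp_rw [div_pow]
      rw [← Finset.sum_div, div_le_one (by positivity)]
      linarith
    · change ∑ i, (4 * (u i - k i / (4 * r))) ^ 2 ≤ 1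
      calc _ ≤ ∑ i : ι, 1 / (r : ℝ) ^ 2 := by
            refine Finset.sum_le_sum fun i _ => ?_
            have h2 : 4 * (u i - k i / (4 * r)) = (4 * r * u i - k i) / r := by
              field_simp
            rw [h2, div_pow]
            have := (sq_le_one_iff_abs_le_one _).2 (hk2 i)
            gcongr
        _ = Fintype.card ι / (r : ℝ) ^ 2 := by simp [div_eq_mul_inv]
        _ ≤ 1 := by
          rw [div_le_one (by positivity)]
          exact_mod_cast hι
  -- Replacing u₀ and then v₀ by grid points costs a quarter of the maximum M each time: M ≤ t + M/4
  -- + M/4.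
  have hs : b u₀ v₀ ≤ 2 * t := by
    obtain ⟨k, hk, hkK, hk4⟩ := happ u₀ hu₀
    obtain ⟨l, hl, hlK, hl4⟩ := happ v₀ hv₀
    have h1 := h k hk l hl
    have h2 := hmax' _ hk4 _ hv₀
    have h3 := hmax' _ hkK _ hl4
    simp only [map_smul, LinearMap.smul_apply, smul_eq_mul, map_sub, LinearMap.sub_apply] at h2 h3
    linarith
  have habs : ∀ w ∈ K, |b w w| ≤ 2 * t := by
    intro w hw
    have hw' : -w ∈ K := by simpa [K] using hw
    rw [abs_le]
    have h1 := hmax' _ hw _ hw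
    have h2 := hmax' _ hw' _ hw
    simp only [map_neg, LinearMap.neg_apply] at h2
    constructor <;> linarith
  set q := ∑ i, u i ^ 2 with hq
  rcases (Finset.sum_nonneg fun i _ => sq_nonneg (u i) : 0 ≤ ∑ i, u i ^ 2).eq_or_lt with h0 | h0
  · have hu : u = 0 := by
      ext i
      have := (Finset.sum_eq_zero_iff_of_nonneg fun i _ => sq_nonneg (u i)).1 h0.symm i
        (Finset.mem_univ i)
      simpa using this
    rw [hq, ← h0, hu]; simp
  · have hq0 : 0 < q := h0
    have hw : (√q)⁻¹ • u ∈ K := by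
      change ∑ i, ((√q)⁻¹ * u i) ^ 2 ≤ 1
      simp_rw [mul_pow, ← Finset.mul_sum]
      rw [← hq, inv_pow, Real.sq_sqrt hq0.le, inv_mul_cancel₀ hq0.ne']
    have h1 := habs _ hw
    simp only [map_smul, LinearMap.smul_apply, smul_eq_mul] at h1
    rw [← mul_assoc, ← mul_inv, Real.mul_self_sqrt hq0.le, abs_mul, abs_of_pos (inv_pos.2 hq0),
      inv_mul_le_iff₀ hq0] at h1
    linarith

theorem sum_half_pow_natAbs_le (R : ℕ) :
    ∑ j ∈ Finset.Icc (-(R : ℤ)) R, (1 / 2 : ℝ) ^ j.natAbs ≤ 4 := by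
  classical
  have hsub : Finset.Icc (-(R : ℤ)) R ⊆
      (Finset.range (R + 1)).image (fun i : ℕ => (i : ℤ)) ∪
        (Finset.range (R + 1)).image (fun i : ℕ => -(i : ℤ)) := by
    intro j hj
    rw [Finset.mem_Icc] at hj
    rw [Finset.mem_union, Finset.mem_image, Finset.mem_image]
    rcases le_total 0 j with h | h
    · exact Or.inl ⟨j.natAbs, by rw [Finset.mem_range]; omega, by omega⟩
    · exact Or.inr ⟨j.natAbs, by rw [Finset.mem_range]; omega, by omega⟩
  have hgeo : ∑ i ∈ Finset.range (R + 1), (1 / 2 : ℝ) ^ i ≤ 2 := sum_geometric_two_le _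
  calc _ ≤ ∑ j ∈ (Finset.range (R + 1)).image (fun i : ℕ => (i : ℤ)) ∪
        (Finset.range (R + 1)).image (fun i : ℕ => -(i : ℤ)), (1 / 2 : ℝ) ^ j.natAbs :=
        Finset.sum_le_sum_of_subset_of_nonneg hsub fun _ _ _ => by positivity
    _ ≤ ∑ j ∈ (Finset.range (R + 1)).image (fun i : ℕ => (i : ℤ)), (1 / 2 : ℝ) ^ j.natAbs +
        ∑ j ∈ (Finset.range (R + 1)).image (fun i : ℕ => -(i : ℤ)), (1 / 2 : ℝ) ^ j.natAbs := by
        rw [← Finset.sum_union_inter]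
        exact le_add_of_nonneg_right (Finset.sum_nonneg fun _ _ => by positivity)
    _ ≤ 2 + 2 := by
        refine add_le_add ?_ ?_
        · rw [Finset.sum_image (fun _ _ _ _ h => by simpa using h)]
          simpa using hgeo
        · rw [Finset.sum_image (fun _ _ _ _ h => by simpa using h)]
          simpa using hgeo
    _ = 4 := by norm_num

/-- Integers satisfy |k| ≤ k², so ∑ |k_i| ≤ 16 r² on the grid and each grid point has weight ∏
2^(-|k_i|) ≥ 2^(-16 r²). The total weight factors over coordinates and is at most 4^(r²). -/
theorem exists_finset_intGrid {r : ℕ} (hι : Fintype.card ι ≤ r ^ 2) :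
    ∃ G : Finset (ι → ℤ), (∀ k, k ∈ G ↔ k ∈ intGrid ι r) ∧ (G.card : ℝ) ≤ 2 ^ (18 * r ^ 2) := by
  classical
  let P : Finset (ι → ℤ) :=
    Fintype.piFinset fun _ => Finset.Icc (-((16 * r ^ 2 : ℕ) : ℤ)) (16 * r ^ 2 : ℕ)
  refine ⟨P.filter (· ∈ intGrid ι r), fun k => ?_, ?_⟩
  · rw [Finset.mem_filter, and_iff_right_iff_imp]
    intro hk
    rw [Fintype.mem_piFinset]
    intro i
    have h1 : k i ^ 2 ≤ 16 * (r : ℤ) ^ 2 :=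
      (Finset.single_le_sum (f := fun i => k i ^ 2) (fun _ _ => sq_nonneg _)
        (Finset.mem_univ i)).trans hk
    rw [Finset.mem_Icc, ← abs_le]
    push_cast
    exact (Int.le_self_sq |k i|).trans (by rwa [sq_abs])
  · have hw : ∀ k ∈ P.filter (· ∈ intGrid ι r),
        (1 : ℝ) ≤ 2 ^ (16 * r ^ 2) * ∏ i, (1 / 2 : ℝ) ^ (k i).natAbs := by
      intro k hk
      have hk' : ∑ i, k i ^ 2 ≤ 16 * (r : ℤ) ^ 2 := (Finset.mem_filter.1 hk).2
      have h1 : ∑ i, (k i).natAbs ≤ 16 * r ^ 2 := by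
        zify
        refine le_trans (Finset.sum_le_sum fun i _ => ?_) hk'
        rw [← sq_abs]
        exact Int.le_self_sq _
      rw [Finset.prod_pow_eq_pow_sum]
      calc (1 : ℝ) = 2 ^ (16 * r ^ 2) * (1 / 2) ^ (16 * r ^ 2) := by
            rw [← mul_pow]; norm_num
        _ ≤ _ := by
          gcongr ?_ * ?_
          exact pow_le_pow_of_le_one (by norm_num) (by norm_num) h1
    calc ((P.filter (· ∈ intGrid ι r)).card : ℝ)
        = ∑ k ∈ P.filter (· ∈ intGrid ι r), (1 : ℝ) := by simp
      _ ≤ ∑ k ∈ P.filter (· ∈ intGrid ι r),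
          2 ^ (16 * r ^ 2) * ∏ i, (1 / 2 : ℝ) ^ (k i).natAbs := Finset.sum_le_sum hw
      _ ≤ ∑ k ∈ P, 2 ^ (16 * r ^ 2) * ∏ i, (1 / 2 : ℝ) ^ (k i).natAbs :=
          Finset.sum_le_sum_of_subset_of_nonneg (Finset.filter_subset _ _)
            fun _ _ _ => by positivity
      _ = 2 ^ (16 * r ^ 2) * ∏ _i : ι,
          ∑ j ∈ Finset.Icc (-((16 * r ^ 2 : ℕ) : ℤ)) (16 * r ^ 2 : ℕ), (1 / 2 : ℝ) ^ j.natAbs := by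
          rw [← Finset.mul_sum, Finset.prod_univ_sum]
      _ ≤ 2 ^ (16 * r ^ 2) * ∏ _i : ι, (4 : ℝ) := by
          gcongr with i
          exact sum_half_pow_natAbs_le _
      _ = 2 ^ (16 * r ^ 2) * 4 ^ Fintype.card ι := by simp
      _ ≤ 2 ^ (16 * r ^ 2) * 4 ^ (r ^ 2) := by
          gcongr
          norm_num
      _ = 2 ^ (18 * r ^ 2) := by
          rw [show (4 : ℝ) = 2 ^ 2 by norm_num, ← pow_mul, ← pow_add]; congr 1; ring

/-- Norm bound for a random bilinear form with independent Gaussian coefficients. -/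
theorem gaussian_bilin_bound {I : Type*} [Fintype I]
    (Φ : I → (ι → ℝ) →ₗ[ℝ] (ι → ℝ) →ₗ[ℝ] ℝ) {r : ℕ} (hr : 0 < r)
    (hι : Fintype.card ι ≤ r ^ 2) {s : ℝ} (hs : 0 < s)
    (hΦ : ∀ u v, ∑ a, Φ a u v ^ 2 ≤ s ^ 2 * ((∑ i, u i ^ 2) * ∑ i, v i ^ 2)) :
    stdGauss I {W | ¬ ∀ u, |∑ a, Φ a u u * W a| ≤ 16 * s * r * ∑ i, u i ^ 2} ≤
      ENNReal.ofReal (Real.exp (-r ^ 2)) := by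
  obtain ⟨G, hG, hGc⟩ := exists_finset_intGrid hι
  have hr' : (0 : ℝ) < r := by exact_mod_cast hr
  let g : (ι → ℤ) → ι → ℝ := fun k i => k i / (4 * r)
  have hg : ∀ k ∈ G, ∑ i, g k i ^ 2 ≤ 1 := by
    intro k hk
    have h1 : ∑ i, (k i : ℝ) ^ 2 ≤ 16 * (r : ℝ) ^ 2 := by
      have : ∑ i, k i ^ 2 ≤ 16 * (r : ℤ) ^ 2 := (hG k).1 hk
      exact_mod_cast this
    simp only [g, div_pow]
    rw [← Finset.sum_div, div_le_one (by positivity)]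
    linarith
  have hsub : {W : I → ℝ | ¬ ∀ u, |∑ a, Φ a u u * W a| ≤ 16 * s * r * ∑ i, u i ^ 2} ⊆
      ⋃ p ∈ G ×ˢ G, {W | 8 * s * r ≤ ∑ a, Φ a (g p.1) (g p.2) * W a} := by
    intro W hW
    by_contra hn
    simp only [Set.mem_iUnion, not_exists, Set.mem_ofPred_eq, not_le] at hn
    refine hW fun u => ?_
    have := bilin_le_of_grid (∑ a, W a • Φ a) hr hι (t := 8 * s * r) (fun k hk l hl => ?_) u
    · simp only [LinearMap.sum_apply, LinearMap.smul_apply, smul_eq_mul] at this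
      simp_rw [mul_comm (Φ _ u u)]
      linarith
    · have := hn (k, l) (Finset.mem_product.2 ⟨(hG k).2 hk, (hG l).2 hl⟩)
      simp only [LinearMap.sum_apply, LinearMap.smul_apply, smul_eq_mul]
      simp_rw [mul_comm (W _)]
      exact this.le
  refine (measure_mono hsub).trans ((measure_biUnion_finset_le _ _).trans ?_)
  have hterm : ∀ p ∈ G ×ˢ G, stdGauss I {W | 8 * s * r ≤ ∑ a, Φ a (g p.1) (g p.2) * W a} ≤
      ENNReal.ofReal (Real.exp (-(32 * r ^ 2))) := by
    intro p hp
    rw [Finset.mem_product] at hp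
    refine (linear_tail _ (v := s ^ 2) (by positivity) ((hΦ _ _).trans ?_)
      (by positivity)).trans (le_of_eq ?_)
    · have := mul_le_one₀ (hg _ hp.1) (Finset.sum_nonneg fun _ _ => sq_nonneg _) (hg _ hp.2)
      nlinarith [sq_nonneg s]
    · congr 2; field_simp; ring
  refine (Finset.sum_le_sum hterm).trans ?_
  rw [Finset.sum_const, nsmul_eq_mul, ← ENNReal.ofReal_natCast,
    ← ENNReal.ofReal_mul (Nat.cast_nonneg _)]
  refine ENNReal.ofReal_le_ofReal ?_
  rw [Finset.card_product, Nat.cast_mul]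
  -- The union bound over pairs of grid points closes because 36 log 2 - 32 < -1.
  calc (G.card : ℝ) * G.card * Real.exp (-(32 * r ^ 2))
      ≤ 2 ^ (18 * r ^ 2) * 2 ^ (18 * r ^ 2) * Real.exp (-(32 * r ^ 2)) := by gcongr
    _ = Real.exp (36 * r ^ 2 * Real.log 2 - 32 * r ^ 2) := by
      rw [← pow_add, sub_eq_add_neg, Real.exp_add]
      congr 1
      rw [mul_comm (36 * (r : ℝ) ^ 2), Real.exp_mul, Real.exp_log (by norm_num),
        ← Real.rpow_natCast]
      congr 1; push_cast; ring
    _ ≤ _ := by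
      apply Real.exp_le_exp.2
      nlinarith [Real.log_two_lt_d9, sq_nonneg (r : ℝ), mul_pos hr' hr']

end Net

/-! ### Monomials and degree on the cube -/

section Cube

variable {n : ℕ}

theorem coord_mul_self_apply (i : Fin n) (x : Cube n) : coord i x * coord i x = 1 := by
  rw [coord, ← Int.cast_mul, ← Units.val_mul, Int.units_mul_self]; simp

theorem mono_eq_prod_univ (S : Finset (Fin n)) (x : Cube n) :
    mono S x = ∏ i, if i ∈ S then coord i x else 1 := by
  rw [Finset.prod_ite_mem_eq, mono, Finset.prod_apply]

theorem mono_mul_mono (S T : Finset (Fin n)) : mono S * mono T = mono (symmDiff S T) := by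
  ext x
  rw [Pi.mul_apply, mono_eq_prod_univ, mono_eq_prod_univ, mono_eq_prod_univ,
    ← Finset.prod_mul_distrib]
  refine Finset.prod_congr rfl fun i _ => ?_
  by_cases hS : i ∈ S <;> by_cases hT : i ∈ T <;>
    simp [hS, hT, Finset.mem_symmDiff, coord_mul_self_apply]

theorem mono_empty : mono (∅ : Finset (Fin n)) = 1 := Finset.prod_empty

theorem mono_singleton (i : Fin n) : mono {i} = coord i := Finset.prod_singleton _ _

theorem mono_mem_degLE {d : ℕ} {S : Finset (Fin n)} (h : S.card ≤ d) : mono S ∈ degLE n d :=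
  Submodule.subset_span ⟨S, h, rfl⟩

theorem one_mem_degLE (d : ℕ) : (1 : CubeFun n) ∈ degLE n d := by
  rw [← mono_empty]; exact mono_mem_degLE (by simp)

theorem coord_mul_mem_degLE {d : ℕ} (i : Fin n) {f : CubeFun n} (hf : f ∈ degLE n d) :
    coord i * f ∈ degLE n (d + 1) := by
  induction hf using Submodule.span_induction with
  | mem f hf =>
    obtain ⟨S, hS, rfl⟩ := hf
    rw [← mono_singleton, mono_mul_mono]
    refine mono_mem_degLE ?_
    have h1 : (symmDiff {i} S).card ≤ ({i} ∪ S).card :=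
      Finset.card_le_card fun j hj => by
        rw [Finset.mem_symmDiff] at hj; rw [Finset.mem_union]; tauto
    have h2 := Finset.card_union_le {i} S
    rw [Finset.card_singleton] at h2
    omega
  | zero => rw [mul_zero]; exact Submodule.zero_mem _
  | add f g _ _ hf hg => rw [mul_add]; exact Submodule.add_mem _ hf hg
  | smul c f _ hf => rw [mul_smul_comm]; exact Submodule.smul_mem _ _ hf

theorem coord_mul_coord_mem_degLE (i j : Fin n) : coord i * coord j ∈ degLE n 2 :=
  coord_mul_mem_degLE i (by rw [← mono_singleton]; exact mono_mem_degLE (by simp))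

end Cube

/-! ### Gram kernels and the Laplacian identity -/

section Spectral

variable {ι : Type*} [Fintype ι]

/-- The pairing of a positive semidefinite kernel with a quadratic form bounded by `K` is at most
`K` times the trace of the kernel. -/
theorem sum_mul_gram_le (w G : ι → ι → ℝ) (hsymm : ∀ p q, G p q = G q p)
    (hG : ∀ u : ι → ℝ, 0 ≤ ∑ p, ∑ q, u p * u q * G p q) {K : ℝ}
    (hw : ∀ u : ι → ℝ, ∑ p, ∑ q, w p q * (u p * u q) ≤ K * ∑ p, u p ^ 2) :
    ∑ p, ∑ q, w p q * G p q ≤ K * ∑ p, G p p := by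
  classical
  open scoped MatrixOrder Matrix.Norms.L2Operator in
  have hpos : (Matrix.of G).PosSemidef := by
    refine .of_dotProduct_mulVec_nonneg (by ext p q; simp [hsymm p q]) fun u => ?_
    refine (hG u).trans (le_of_eq ?_)
    simp only [dotProduct, Matrix.mulVec, Matrix.of_apply, Finset.mul_sum]
    refine Finset.sum_congr rfl fun p _ => Finset.sum_congr rfl fun q _ => ?_
    simp only [Pi.star_apply, star_trivial]; ring
  -- A factorization G = Bᵀ B writes the kernel as a sum of rank-one kernels, to each of which the
  -- bound on `w` applies.
  have hB : ∃ B : Matrix ι ι ℝ, Matrix.of G = star B * B := by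
    open scoped MatrixOrder Matrix.Norms.L2Operator in
    exact CStarAlgebra.nonneg_iff_eq_star_mul_self.mp hpos.nonneg
  obtain ⟨B, hB⟩ := hB
  have hGB : ∀ p q, G p q = ∑ r, B r p * B r q := by
    intro p q
    have := congrFun (congrFun hB p) q
    simpa [Matrix.mul_apply, Matrix.star_apply] using this
  calc ∑ p, ∑ q, w p q * G p q = ∑ r, ∑ p, ∑ q, w p q * (B r p * B r q) := by
        simp_rw [hGB, Finset.mul_sum]
        conv_lhs => enter [2, p]; rw [Finset.sum_comm]
        rw [Finset.sum_comm]
    _ ≤ ∑ r, K * ∑ p, B r p ^ 2 := Finset.sum_le_sum fun r _ => hw (B r)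
    _ = K * ∑ p, G p p := by
        simp_rw [hGB]
        rw [← Finset.mul_sum, Finset.sum_comm]
        simp_rw [pow_two]

/-- The Laplacian of a perturbed complete graph, written with respect to centred variables. -/
theorem sum_one_sub_mul_eq (w : ι → ι → ℝ) (σ : ℝ) (X Y : ι → ℝ) (m : ℝ)
    (hX : ∀ p, X p * X p = 1) (hY : ∀ p, Y p = X p - m) (hsum : ∑ p, Y p = 0) :
    ∑ p, ∑ q, (1 + σ * w p q) * (1 - X p * X q) =
      ∑ p, (Fintype.card ι + σ * (∑ q, w p q + ∑ q, w q p) / 2) * (Y p * Y p) -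
        σ * ∑ p, ∑ q, w p q * (Y p * Y q) := by
  have h1 : ∀ p q, (1 + σ * w p q) * (1 - X p * X q) =
      (1 / 2) * (Y p * Y p) + (1 / 2) * (Y q * Y q) - Y p * Y q
        + (σ / 2) * (w p q * (Y p * Y p)) + (σ / 2) * (w p q * (Y q * Y q))
        - σ * (w p q * (Y p * Y q)) := by
    intro p q
    have e : 1 - X p * X q = (Y p - Y q) * (Y p - Y q) / 2 := by
      rw [hY, hY]
      linear_combination (-1 / 2) * hX p - (1 / 2) * hX q
    rw [e]; ring
  simp_rw [h1, Finset.sum_sub_distrib, Finset.sum_add_distrib, Finset.sum_sub_distrib,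
    Finset.sum_add_distrib]
  -- Centring removes the off-diagonal part of the all-ones matrix; this is the source of the
  -- spectral gap `Fintype.card ι`.
  have h2 : ∑ p, ∑ q, Y p * Y q = 0 := by
    simp_rw [← Finset.mul_sum, hsum]; simp
  have h3 : ∑ p, ∑ _q : ι, (1 / 2) * (Y p * Y p) = (Fintype.card ι / 2) * ∑ p, Y p * Y p := by
    simp only [Finset.sum_const, Finset.card_univ, nsmul_eq_mul, ← Finset.mul_sum]; ring
  have h4 : ∑ _p : ι, ∑ q, (1 / 2) * (Y q * Y q) = (Fintype.card ι / 2) * ∑ p, Y p * Y p := by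
    simp only [Finset.sum_const, Finset.card_univ, nsmul_eq_mul, ← Finset.mul_sum]; ring
  have h5 : ∑ p, ∑ q, (σ / 2) * (w p q * (Y p * Y p)) =
      ∑ p, (σ * (∑ q, w p q) / 2) * (Y p * Y p) := by
    refine Finset.sum_congr rfl fun p _ => ?_
    rw [← Finset.mul_sum, ← Finset.sum_mul]; ring
  have h6 : ∑ p, ∑ q, (σ / 2) * (w p q * (Y q * Y q)) =
      ∑ p, (σ * (∑ q, w q p) / 2) * (Y p * Y p) := by
    rw [Finset.sum_comm]
    refine Finset.sum_congr rfl fun p _ => ?_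
    rw [← Finset.mul_sum, ← Finset.sum_mul]; ring
  rw [h2, h3, h4, h5, h6]
  simp_rw [← Finset.mul_sum]
  rw [sub_zero]
  congr 1
  have h7 : ∀ p, (Fintype.card ι + σ * (∑ q, w p q + ∑ q, w q p) / 2) * (Y p * Y p) =
      Fintype.card ι * (Y p * Y p) + (σ * (∑ q, w p q) / 2) * (Y p * Y p) +
        (σ * (∑ q, w q p) / 2) * (Y p * Y p) := fun p => by ring
  simp_rw [h7, Finset.sum_add_distrib, ← Finset.mul_sum]
  ring

end Spectral

/-! ### Deterministic recovery criterion -/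

section Recovery

variable {n : ℕ}

/-- Index quadruples as pairs of pairs. -/
def quadEquiv (n : ℕ) : (Fin 4 → Fin n) ≃ (Fin n × Fin n) × (Fin n × Fin n) where
  toFun a := ((a 0, a 1), (a 2, a 3))
  invFun p := ![p.1.1, p.1.2, p.2.1, p.2.2]
  left_inv a := by ext k; fin_cases k <;> rfl
  right_inv _ := rfl

theorem sum_quad (F : (Fin 4 → Fin n) → ℝ) :
    ∑ a, F a = ∑ p, ∑ q, F ((quadEquiv n).symm (p, q)) := by
  rw [← (quadEquiv n).symm.sum_comp F, Fintype.sum_prod_type]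

theorem tensorPow_quad (x : Cube n) (p q : Fin n × Fin n) :
    tensorPow x ((quadEquiv n).symm (p, q)) =
      (coord p.1 x * coord p.2 x) * (coord q.1 x * coord q.2 x) := by
  rw [tensorPow, Fin.prod_univ_four, ← mul_assoc]
  rfl

/-- The sign `y_i y_j` of a pair of indices. -/
def pairSign (y : Cube n) (p : Fin n × Fin n) : ℝ := coord p.1 y * coord p.2 y

theorem pairSign_sq (y : Cube n) (p : Fin n × Fin n) : pairSign y p * pairSign y p = 1 := by
  have h1 := coord_mul_self_apply p.1 y
  have h2 := coord_mul_self_apply p.2 y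
  unfold pairSign
  linear_combination coord p.2 y * coord p.2 y * h1 + h2

/-- The noise tensor as a matrix indexed by pairs, in coordinates in which the signal is
constant. -/
def noise (y : Cube n) (W : Tensor n) (p q : Fin n × Fin n) : ℝ :=
  pairSign y p * pairSign y q * W ((quadEquiv n).symm (p, q))

/-- The function `x ↦ y_i y_j x_i x_j`. -/
def signedPair (y : Cube n) (p : Fin n × Fin n) : CubeFun n := fun x => pairSign y p * pairSign x p

theorem signedPair_eq (y : Cube n) (p : Fin n × Fin n) :
    signedPair y p = pairSign y p • (coord p.1 * coord p.2) := rfl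

theorem signedPair_mem (y : Cube n) (p : Fin n × Fin n) : signedPair y p ∈ degLE n 2 := by
  rw [signedPair_eq]
  exact Submodule.smul_mem _ _ (coord_mul_coord_mem_degLE _ _)

theorem signedPair_sq (y : Cube n) (p : Fin n × Fin n) (x : Cube n) :
    signedPair y p x * signedPair y p x = 1 := by
  unfold signedPair
  linear_combination pairSign x p * pairSign x p * pairSign_sq y p + pairSign_sq x p

theorem signedPair_self (y : Cube n) (p : Fin n × Fin n) : signedPair y p y = 1 := pairSign_sq y p

theorem objective_spiked_eq (y : Cube n) (σ : ℝ) (W : Tensor n) (x : Cube n) :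
    objective (spiked y σ W) x =
      ∑ p, ∑ q, (1 + σ * noise y W p q) * (signedPair y p x * signedPair y q x) := by
  rw [objective, sum_quad]
  refine Finset.sum_congr rfl fun p _ => Finset.sum_congr rfl fun q _ => ?_
  simp only [spiked, Pi.add_apply, Pi.smul_apply, smul_eq_mul, tensorPow_quad, noise, signedPair]
  change (pairSign y p * pairSign y q + σ * _) * (pairSign x p * pairSign x q) = _
  linear_combination (-σ * W ((quadEquiv n).symm (p, q)) * pairSign x p * pairSign x q) *
    (pairSign y q * pairSign y q * pairSign_sq y p + pairSign_sq y q)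

theorem unifPair_apply (y : Cube n) (f : CubeFun n) : unifPair y f = (f y + f (-y)) / 2 := by
  simp [unifPair]; ring

theorem coord_neg (i : Fin n) (x : Cube n) : coord i (-x) = -coord i x := by simp [coord]

theorem objective_neg (T : Tensor n) (x : Cube n) : objective T (-x) = objective T x := by
  simp [objective, tensorPow, coord_neg, Fin.prod_univ_four]

theorem unifPair_objective (y : Cube n) (T : Tensor n) :
    unifPair y (objective T) = objective T y := by
  rw [unifPair_apply, objective_neg]; ring

theorem mono_neg {S : Finset (Fin n)} (hS : Even S.card) (x : Cube n) :
    mono S (-x) = mono S x := by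
  simp only [mono, Finset.prod_apply, coord_neg]
  rw [Finset.prod_neg, hS.neg_one_pow, one_mul]

theorem unifPair_mono (y : Cube n) {S : Finset (Fin n)} (hS : Even S.card) :
    unifPair y (mono S) = mono S y := by
  rw [unifPair_apply, mono_neg hS]; ring

/-- The balance of y enters part (1) only here; the upper bound on the value holds for every
degree-4 pseudo-expectation. -/
theorem unifPair_mem_feasible (y : Cube n) (hy : ∑ i, coord i y = 0) : unifPair y ∈ feasible n := by
  refine ⟨⟨by simp [unifPair_apply], fun q _ => ?_⟩, fun q _ => ?_⟩
  · rw [unifPair_apply]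
    simp only [Pi.mul_apply]
    nlinarith [mul_self_nonneg (q y), mul_self_nonneg (q (-y))]
  · rw [unifPair_apply]
    simp [Finset.sum_apply, coord_neg, hy]

/-- The centred version of `signedPair`. -/
noncomputable def centredPair (y : Cube n) (p : Fin n × Fin n) : CubeFun n :=
  signedPair y p - (Fintype.card (Fin n × Fin n) : ℝ)⁻¹ • ∑ q, signedPair y q

theorem centredPair_mem (y : Cube n) (p : Fin n × Fin n) : centredPair y p ∈ degLE n 2 :=
  Submodule.sub_mem _ (signedPair_mem y p)
    (Submodule.smul_mem _ _ (Submodule.sum_mem _ fun q _ => signedPair_mem y q))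

/-- The value of a pseudo-expectation falls short of the value at `y` by a multiple of the total
pseudo-variance of the pair variables. -/
theorem value_add_le (hn : 0 < n) (y : Cube n) {σ : ℝ} (hσ : 0 ≤ σ) (W : Tensor n) {R K : ℝ}
    (hrow : ∀ p, -R ≤ ∑ q, noise y W p q) (hcol : ∀ p, -R ≤ ∑ q, noise y W q p)
    (hquad : ∀ u : Fin n × Fin n → ℝ,
      ∑ p, ∑ q, noise y W p q * (u p * u q) ≤ K * ∑ p, u p ^ 2)
    {E : CubeFun n →ₗ[ℝ] ℝ} (hE : IsPseudoExpectation 2 E) :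
    E (objective (spiked y σ W)) +
        ((n : ℝ) ^ 2 - σ * R - σ * K) * ∑ p, E (centredPair y p * centredPair y p) ≤
      objective (spiked y σ W) y := by
  have hcard : (Fintype.card (Fin n × Fin n) : ℝ) = (n : ℝ) ^ 2 := by simp; ring
  have hcard0 : (Fintype.card (Fin n × Fin n) : ℝ) ≠ 0 := by rw [hcard]; positivity
  -- The Laplacian identity holds pointwise on the cube, hence as an identity of functions to which
  -- E can be applied.
  have hfun : objective (spiked y σ W) = objective (spiked y σ W) y • (1 : CubeFun n) -
      (∑ p, ((n : ℝ) ^ 2 + σ * (∑ q, noise y W p q + ∑ q, noise y W q p) / 2) •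
        (centredPair y p * centredPair y p) -
        σ • ∑ p, ∑ q, noise y W p q • (centredPair y p * centredPair y q)) := by
    ext x
    have h := sum_one_sub_mul_eq (noise y W) σ (fun p => signedPair y p x)
      (fun p => centredPair y p x)
      ((Fintype.card (Fin n × Fin n) : ℝ)⁻¹ * ∑ q, signedPair y q x)
      (fun p => signedPair_sq y p x) (fun p => by simp [centredPair, Finset.sum_apply])
      (by
        simp only [centredPair, Pi.sub_apply, Pi.smul_apply, Finset.sum_apply, smul_eq_mul,
          Finset.sum_sub_distrib, Finset.sum_const, Finset.card_univ, nsmul_eq_mul]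
        rw [← mul_assoc, mul_inv_cancel₀ hcard0, one_mul, sub_self])
    rw [hcard] at h
    simp only [Pi.sub_apply, Pi.smul_apply, Finset.sum_apply, smul_eq_mul, Pi.one_apply,
      Pi.mul_apply]
    rw [← h, objective_spiked_eq, objective_spiked_eq]
    simp only [signedPair_self, mul_sub, mul_one, Finset.sum_sub_distrib]
    ring
  have hEf : E (objective (spiked y σ W)) = objective (spiked y σ W) y -
      (∑ p, ((n : ℝ) ^ 2 + σ * (∑ q, noise y W p q + ∑ q, noise y W q p) / 2) *
        E (centredPair y p * centredPair y p) -
        σ * ∑ p, ∑ q, noise y W p q * E (centredPair y p * centredPair y q)) := by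
    conv_lhs => rw [hfun]
    simp only [map_sub, map_smul, map_sum, smul_eq_mul, hE.map_one, mul_one]
  -- The pseudo-covariance of the centred pairs is positive semidefinite because they have degree at
  -- most 2.
  have hG := sum_mul_gram_le (noise y W) (fun p q => E (centredPair y p * centredPair y q))
    (fun p q => by rw [mul_comm]) (fun u => by
      have h := hE.sq_nonneg (∑ p, u p • centredPair y p)
        (Submodule.sum_mem _ fun p _ => Submodule.smul_mem _ _ (centredPair_mem y p))
      rw [Finset.sum_mul_sum] at h
      simp only [map_sum, smul_mul_smul_comm, map_smul, smul_eq_mul] at h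
      exact h) hquad
  have hdiag : ((n : ℝ) ^ 2 - σ * R) * ∑ p, E (centredPair y p * centredPair y p) ≤
      ∑ p, ((n : ℝ) ^ 2 + σ * (∑ q, noise y W p q + ∑ q, noise y W q p) / 2) *
        E (centredPair y p * centredPair y p) := by
    rw [Finset.mul_sum]
    refine Finset.sum_le_sum fun p _ => ?_
    refine mul_le_mul_of_nonneg_right ?_ (hE.sq_nonneg _ (centredPair_mem y p))
    nlinarith [mul_le_mul_of_nonneg_left (add_le_add (hrow p) (hcol p)) hσ]
  have := mul_le_mul_of_nonneg_left hG hσ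
  rw [hEf]
  nlinarith

/-- If E[Y_p²] = E[Y_q²] = 0, positivity on (Y_p ± Y_q)² forces E[Y_p Y_q] = 0. The claim follows
from 1 - X_p X_q = (Y_p - Y_q)² / 2, in which the mean cancels. -/
theorem map_signedPair_mul_eq_one (y : Cube n) {E : CubeFun n →ₗ[ℝ] ℝ}
    (hE : IsPseudoExpectation 2 E)
    (h0 : ∑ p, E (centredPair y p * centredPair y p) = 0) (p q : Fin n × Fin n) :
    E (signedPair y p * signedPair y q) = 1 := by
  have hz : ∀ p, E (centredPair y p * centredPair y p) = 0 := fun p =>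
    (Finset.sum_eq_zero_iff_of_nonneg fun p _ => hE.sq_nonneg _ (centredPair_mem y p)).1 h0 p
      (Finset.mem_univ p)
  have h1 := hE.sq_nonneg (centredPair y p + centredPair y q)
    (Submodule.add_mem _ (centredPair_mem y p) (centredPair_mem y q))
  have h2 := hE.sq_nonneg (centredPair y p - centredPair y q)
    (Submodule.sub_mem _ (centredPair_mem y p) (centredPair_mem y q))
  have e1 : (centredPair y p + centredPair y q) * (centredPair y p + centredPair y q) =
      centredPair y p * centredPair y p + (2 : ℝ) • (centredPair y p * centredPair y q) +
        centredPair y q * centredPair y q := by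
    rw [two_smul]; ring
  have e2 : (centredPair y p - centredPair y q) * (centredPair y p - centredPair y q) =
      centredPair y p * centredPair y p - (2 : ℝ) • (centredPair y p * centredPair y q) +
        centredPair y q * centredPair y q := by
    rw [two_smul]; ring
  have e3 : signedPair y p * signedPair y q =
      1 - (1 / 2 : ℝ) •
        ((centredPair y p - centredPair y q) * (centredPair y p - centredPair y q)) := by
    ext x
    have hp := signedPair_sq y p x
    have hq := signedPair_sq y q x
    simp only [centredPair, Pi.mul_apply, Pi.sub_apply, Pi.smul_apply, Pi.one_apply, smul_eq_mul]
    linear_combination (1 / 2) * hp + (1 / 2) * hq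
  rw [e1, map_add, map_add, map_smul, hz, hz] at h1
  rw [e3, map_sub, hE.map_one, map_smul, e2, map_add, map_sub, map_smul, hz, hz]
  rw [e2, map_add, map_sub, map_smul, hz, hz] at h2
  simp only [smul_eq_mul] at h1 h2 ⊢
  linarith

theorem map_mono_of_pairs (hn : 0 < n) (y : Cube n) {E : CubeFun n →ₗ[ℝ] ℝ}
    (h : ∀ p q, E (signedPair y p * signedPair y q) = 1) (S : Finset (Fin n)) (hS : S.card ≤ 4)
    (hS2 : Even S.card) : E (mono S) = mono S y := by
  have key : ∀ p q, E ((coord p.1 * coord p.2) * (coord q.1 * coord q.2)) =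
      pairSign y p * pairSign y q := by
    intro p q
    have h1 := h p q
    rw [signedPair_eq, signedPair_eq, smul_mul_smul_comm, map_smul, smul_eq_mul] at h1
    linear_combination (pairSign y p * pairSign y q) * h1 -
      E ((coord p.1 * coord p.2) * (coord q.1 * coord q.2)) *
        (pairSign y q * pairSign y q * pairSign_sq y p + pairSign_sq y q)
  have hone : ∀ i : Fin n, coord i * coord i = (1 : CubeFun n) := fun i => by
    ext x; exact coord_mul_self_apply i x
  have hcases : S.card = 0 ∨ S.card = 2 ∨ S.card = 4 := by
    obtain ⟨k, hk⟩ := hS2; omega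
  rcases hcases with h0 | h2 | h4
  · rw [Finset.card_eq_zero.1 h0, mono_empty]
    have := key (⟨0, hn⟩, ⟨0, hn⟩) (⟨0, hn⟩, ⟨0, hn⟩)
    simp only [hone, mul_one, pairSign, coord_mul_self_apply] at this
    exact this
  · obtain ⟨i, j, hij, rfl⟩ := Finset.card_eq_two.1 h2
    -- The diagonal pair (i, i) gives the constant 1, so products of two pairs also cover degree 2.
    have := key (i, j) (i, i)
    simp only [hone, mul_one, pairSign, coord_mul_self_apply] at this
    rw [mono, Finset.prod_pair hij, this]; rfl
  · obtain ⟨i, T, hi, rfl, hT⟩ := Finset.card_eq_succ.1 h4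
    obtain ⟨j, k, l, hjk, hjl, hkl, rfl⟩ := Finset.card_eq_three.1 hT
    have := key (i, j) (k, l)
    have e : mono (insert i {j, k, l}) = coord i * coord j * (coord k * coord l) := by
      rw [mono, Finset.prod_insert hi, Finset.prod_insert (by simp [hjk, hjl]),
        Finset.prod_pair hkl]
      ring
    rw [e, this]; rfl

theorem recovers_of_bounds (hn : 0 < n) (y : Cube n) (hy : ∑ i, coord i y = 0) {σ : ℝ}
    (hσ : 0 ≤ σ) (W : Tensor n) {R K : ℝ}
    (hrow : ∀ p, -R ≤ ∑ q, noise y W p q) (hcol : ∀ p, -R ≤ ∑ q, noise y W q p)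
    (hquad : ∀ u : Fin n × Fin n → ℝ,
      ∑ p, ∑ q, noise y W p q * (u p * u q) ≤ K * ∑ p, u p ^ 2)
    (hgap : σ * R + σ * K < (n : ℝ) ^ 2) :
    Recovers (objective (spiked y σ W)) y := by
  have hnn : ∀ E ∈ feasible n, 0 ≤ ∑ p, E (centredPair y p * centredPair y p) := fun E hE =>
    Finset.sum_nonneg fun p _ => hE.1.sq_nonneg _ (centredPair_mem y p)
  refine ⟨unifPair_mem_feasible y hy, fun E hE => ?_, fun E hE heq S hS hS2 => ?_⟩
  · rw [unifPair_objective]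
    have := value_add_le hn y hσ W hrow hcol hquad hE.1
    nlinarith [mul_nonneg (show 0 ≤ (n : ℝ) ^ 2 - σ * R - σ * K by linarith) (hnn E hE)]
  · rw [unifPair_objective] at heq
    have := value_add_le hn y hσ W hrow hcol hquad hE.1
    rw [heq] at this
    have h0 : ∑ p, E (centredPair y p * centredPair y p) = 0 := by
      refine le_antisymm ?_ (hnn E hE)
      by_contra hlt
      have := mul_pos (show 0 < (n : ℝ) ^ 2 - σ * R - σ * K by linarith) (not_le.1 hlt)
      linarith
    rw [unifPair_mono y hS2]
    exact map_mono_of_pairs hn y (map_signedPair_mul_eq_one y hE.1 h0) S hS hS2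

end Recovery

/-! ### Probability of recovery below the threshold -/

section RecoveryProbability

variable {n : ℕ}

theorem sum_quadEquiv_mul (c : Fin n × Fin n → Fin n × Fin n → ℝ) (W : Tensor n) :
    ∑ a, c (quadEquiv n a).1 (quadEquiv n a).2 * W a =
      ∑ p, ∑ q, c p q * W ((quadEquiv n).symm (p, q)) := by
  rw [sum_quad]; simp

theorem sum_quadEquiv_sq (c : Fin n × Fin n → Fin n × Fin n → ℝ) :
    ∑ a, c (quadEquiv n a).1 (quadEquiv n a).2 ^ 2 = ∑ p, ∑ q, c p q ^ 2 := by
  rw [sum_quad]; simp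

theorem pairSign_mul_sq (y : Cube n) (p q : Fin n × Fin n) :
    (pairSign y p * pairSign y q) ^ 2 = 1 := by
  linear_combination pairSign y q * pairSign y q * pairSign_sq y p + pairSign_sq y q

theorem sum_noise_tail (hn : 0 < n) {R : ℝ} (hR : 0 ≤ R) (c : Fin n × Fin n → Fin n × Fin n → ℝ)
    (hc : ∑ p, ∑ q, c p q ^ 2 ≤ (n : ℝ) ^ 2) :
    gaussianTensor n {W | ∑ p, ∑ q, c p q * W ((quadEquiv n).symm (p, q)) < -R} ≤
      ENNReal.ofReal (Real.exp (-R ^ 2 / (2 * (n : ℝ) ^ 2))) := by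
  refine (measure_mono fun W hW => ?_).trans
    (linear_tail (fun a => -c (quadEquiv n a).1 (quadEquiv n a).2) (v := (n : ℝ) ^ 2)
      (by positivity) ?_ hR)
  · rw [Set.mem_ofPred_eq] at hW ⊢
    simp only [neg_mul, Finset.sum_neg_distrib]
    rw [sum_quadEquiv_mul]
    linarith
  · simp only [neg_sq]
    rw [sum_quadEquiv_sq]
    exact hc

theorem row_tail (hn : 0 < n) {R : ℝ} (hR : 0 ≤ R) (y : Cube n) (p : Fin n × Fin n) :
    gaussianTensor n {W | ∑ q, noise y W p q < -R} ≤
      ENNReal.ofReal (Real.exp (-R ^ 2 / (2 * (n : ℝ) ^ 2))) := by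
  convert sum_noise_tail hn hR (fun p' q => if p' = p then pairSign y p' * pairSign y q else 0) ?_
    using 4 with W
  · simp [ite_mul, Finset.sum_ite_irrel, noise]
  · simp only [ite_pow, pairSign_mul_sq]
    simp [Finset.sum_ite_irrel]
    nlinarith

theorem col_tail (hn : 0 < n) {R : ℝ} (hR : 0 ≤ R) (y : Cube n) (p : Fin n × Fin n) :
    gaussianTensor n {W | ∑ q, noise y W q p < -R} ≤
      ENNReal.ofReal (Real.exp (-R ^ 2 / (2 * (n : ℝ) ^ 2))) := by
  convert sum_noise_tail hn hR (fun q p' => if p' = p then pairSign y q * pairSign y p' else 0) ?_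
    using 4 with W
  · simp [ite_mul, noise]
  · simp only [ite_pow, pairSign_mul_sq]
    simp
    nlinarith

/-- The noise as a random bilinear form on vectors indexed by pairs. -/
def noiseForm (y : Cube n) (a : Fin 4 → Fin n) :
    (Fin n × Fin n → ℝ) →ₗ[ℝ] (Fin n × Fin n → ℝ) →ₗ[ℝ] ℝ :=
  LinearMap.mk₂ ℝ
    (fun u v => pairSign y (quadEquiv n a).1 * pairSign y (quadEquiv n a).2 *
      (u (quadEquiv n a).1 * v (quadEquiv n a).2))
    (fun _ _ _ => by simp only [Pi.add_apply]; ring)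
    (fun _ _ _ => by simp only [Pi.smul_apply, smul_eq_mul]; ring)
    (fun _ _ _ => by simp only [Pi.add_apply]; ring)
    (fun _ _ _ => by simp only [Pi.smul_apply, smul_eq_mul]; ring)

theorem noiseForm_apply (y : Cube n) (a : Fin 4 → Fin n) (u v : Fin n × Fin n → ℝ) :
    noiseForm y a u v = pairSign y (quadEquiv n a).1 * pairSign y (quadEquiv n a).2 *
      (u (quadEquiv n a).1 * v (quadEquiv n a).2) := rfl

theorem quad_tail (hn : 0 < n) (y : Cube n) :
    gaussianTensor n {W | ¬ ∀ u : Fin n × Fin n → ℝ,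
      ∑ p, ∑ q, noise y W p q * (u p * u q) ≤ 16 * n * ∑ p, u p ^ 2} ≤
      ENNReal.ofReal (Real.exp (-(n : ℝ) ^ 2)) := by
  refine (measure_mono fun W hW => ?_).trans
    (gaussian_bilin_bound (noiseForm y) hn (by simp [pow_two]) (s := 1) one_pos fun u v => ?_)
  · rw [Set.mem_ofPred_eq] at hW ⊢
    contrapose! hW
    intro u
    have h := (le_abs_self _).trans (hW u)
    simp only [noiseForm_apply] at h
    rw [sum_quadEquiv_mul (fun p q => pairSign y p * pairSign y q * (u p * u q))] at h
    rw [mul_one] at h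
    refine le_trans (le_of_eq ?_) h
    refine Finset.sum_congr rfl fun p _ => Finset.sum_congr rfl fun q _ => ?_
    rw [noise]; ring
  · simp only [noiseForm_apply]
    rw [sum_quadEquiv_sq (fun p q => pairSign y p * pairSign y q * (u p * v q))]
    simp_rw [mul_pow (pairSign y _ * pairSign y _), pairSign_mul_sq]
    rw [Finset.sum_mul_sum]
    simp [mul_pow]

theorem not_recovers_le (hn : 3 ≤ n) (y : Cube n) (hy : ∑ i, coord i y = 0) {σ : ℝ}
    (hσ : 0 ≤ σ) (hσ' : σ ≤ 1 / 100 * (n / √(Real.log n))) :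
    gaussianTensor n {W | ¬ Recovers (objective (spiked y σ W)) y} ≤
      ENNReal.ofReal (3 / n) := by
  have hn0 : 0 < n := by omega
  have hnR : (3 : ℝ) ≤ n := by exact_mod_cast hn
  have hlog : 1 ≤ Real.log n := by
    rw [Real.le_log_iff_exp_le (by linarith)]
    linarith [Real.exp_one_lt_d9]
  set l := √(Real.log n) with hl
  have hl1 : 1 ≤ l := by rw [hl]; exact Real.one_le_sqrt.2 hlog
  have hlsq : l ^ 2 = Real.log n := Real.sq_sqrt (by linarith)
  -- Each row or column sum has variance n², so its tail at -R is n^(-9/2) ≤ n^(-4), which beats the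
  -- union over 2n² sums.
  set R := 3 * n * l with hR
  have hR0 : 0 ≤ R := by positivity
  have hexp : Real.exp (-R ^ 2 / (2 * (n : ℝ) ^ 2)) ≤ 1 / (n : ℝ) ^ 4 := by
    have h1 : -R ^ 2 / (2 * (n : ℝ) ^ 2) = -(9 / 2) * Real.log n := by
      rw [← hlsq, hR]; field_simp; norm_num
    rw [h1]
    calc Real.exp (-(9 / 2) * Real.log n) ≤ Real.exp (-(4 * Real.log n)) :=
          Real.exp_le_exp.2 (by linarith)
      _ = 1 / (n : ℝ) ^ 4 := by
          rw [Real.exp_neg, one_div]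
          congr 1
          rw [show (4 : ℝ) * Real.log n = ((4 : ℕ) : ℝ) * Real.log n by norm_num, Real.exp_nat_mul,
            Real.exp_log (by linarith)]
  have hsub : {W | ¬ Recovers (objective (spiked y σ W)) y} ⊆
      ((⋃ p ∈ (Finset.univ : Finset (Fin n × Fin n)), {W | ∑ q, noise y W p q < -R}) ∪
        (⋃ p ∈ (Finset.univ : Finset (Fin n × Fin n)), {W | ∑ q, noise y W q p < -R})) ∪
      {W | ¬ ∀ u : Fin n × Fin n → ℝ,
        ∑ p, ∑ q, noise y W p q * (u p * u q) ≤ 16 * n * ∑ p, u p ^ 2} := by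
    intro W hW
    by_contra h
    simp only [Set.mem_union, Set.mem_iUnion, Set.mem_ofPred_eq, not_or, not_exists, not_lt,
      not_not, Finset.mem_univ, true_implies] at h
    refine hW (recovers_of_bounds hn0 y hy hσ W h.1.1 h.1.2 h.2 ?_)
    -- This gives σ R ≤ 3n²/100 and σ · 16n ≤ 16n²/100, well below the gap n².
    have h1 : σ * l ≤ 1 / 100 * n := by
      calc σ * l ≤ 1 / 100 * (n / l) * l := by gcongr
        _ = _ := by field_simp
    have h2 : σ ≤ 1 / 100 * n := (le_mul_of_one_le_right hσ hl1).trans h1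
    rw [hR]
    nlinarith
  have hU : ∀ f : Fin n × Fin n → Set (Tensor n),
      (∀ p, gaussianTensor n (f p) ≤ ENNReal.ofReal (Real.exp (-R ^ 2 / (2 * (n : ℝ) ^ 2)))) →
      gaussianTensor n (⋃ p ∈ (Finset.univ : Finset (Fin n × Fin n)), f p) ≤
        ENNReal.ofReal (1 / (n : ℝ) ^ 2) := by
    intro f hf
    refine (measure_biUnion_finset_le _ _).trans ((Finset.sum_le_sum fun p _ => hf p).trans ?_)
    rw [Finset.sum_const, nsmul_eq_mul, ← ENNReal.ofReal_natCast,
      ← ENNReal.ofReal_mul (Nat.cast_nonneg _)]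
    refine ENNReal.ofReal_le_ofReal ?_
    calc _ ≤ ((n : ℝ) * n) * (1 / (n : ℝ) ^ 4) := by
          simp only [Finset.card_univ, Fintype.card_prod, Fintype.card_fin, Nat.cast_mul]
          gcongr
      _ = _ := by field_simp
  refine (measure_mono hsub).trans ((measure_union_le _ _).trans ?_)
  have hA := (measure_union_le (μ := gaussianTensor n)
    (⋃ p ∈ (Finset.univ : Finset (Fin n × Fin n)), {W | ∑ q, noise y W p q < -R})
    (⋃ p ∈ (Finset.univ : Finset (Fin n × Fin n)), {W | ∑ q, noise y W q p < -R})).trans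
    (add_le_add (hU _ fun p => row_tail hn0 hR0 y p) (hU _ fun p => col_tail hn0 hR0 y p))
  refine (add_le_add hA (quad_tail hn0 y)).trans ?_
  rw [← ENNReal.ofReal_add (by positivity) (by positivity),
    ← ENNReal.ofReal_add (by positivity) (by positivity)]
  refine ENNReal.ofReal_le_ofReal ?_
  have h3 : Real.exp (-(n : ℝ) ^ 2) ≤ 1 / (n : ℝ) ^ 2 := by
    rw [Real.exp_neg, one_div]
    exact inv_anti₀ (by positivity) (by linarith [Real.add_one_le_exp ((n : ℝ) ^ 2)])
  calc _ ≤ 1 / (n : ℝ) ^ 2 + 1 / (n : ℝ) ^ 2 + 1 / (n : ℝ) ^ 2 := by gcongr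
    _ = 3 / (n : ℝ) ^ 2 := by ring
    _ ≤ 3 / n := by
      gcongr
      nlinarith

theorem recovery_below_threshold : ∃ C : ℝ, 0 < C ∧ ∀ δ : ℝ, 0 < δ → ∀ᶠ n : ℕ in atTop,
    ∀ y : Cube n, ∑ i, coord i y = 0 →
    ∀ σ : ℝ, 0 ≤ σ → σ ≤ C * (n / √(Real.log n)) →
      gaussianTensor n {W | ¬ Recovers (objective (spiked y σ W)) y} ≤ ENNReal.ofReal δ := by
  refine ⟨1 / 100, by norm_num, fun δ hδ => ?_⟩
  filter_upwards [eventually_ge_atTop 3, eventually_ge_atTop ⌈3 / δ⌉₊] with n hn hnδ y hy σ hσ hσ'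
  refine (not_recovers_le hn y hy hσ hσ').trans (ENNReal.ofReal_le_ofReal ?_)
  have hn0 : (0 : ℝ) < n := by exact_mod_cast (show 0 < n by omega)
  have := Nat.ceil_le.1 hnδ
  rw [div_le_iff₀ hδ] at this
  rw [div_le_iff₀ hn0]
  linarith

end RecoveryProbability

/-! ### Fourier analysis of quadratic polynomials -/

section Fourier

variable {m : ℕ}

/-- The expectation with respect to the uniform distribution on the cube. -/
noncomputable def avg (m : ℕ) : CubeFun m →ₗ[ℝ] ℝ :=
  ((2 : ℝ) ^ m)⁻¹ • ∑ z : Cube m, LinearMap.proj z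

theorem avg_apply (f : CubeFun m) : avg m f = ((2 : ℝ) ^ m)⁻¹ * ∑ z, f z := by
  simp [avg]

theorem avg_mono (S : Finset (Fin m)) : avg m (mono S) = if S = ∅ then 1 else 0 := by
  have h : ∑ z : Cube m, mono S z = ∏ i, ∑ t : ℤˣ, if i ∈ S then ((t : ℤ) : ℝ) else 1 := by
    rw [Finset.prod_univ_sum]
    simp only [Fintype.piFinset_univ]
    exact Finset.sum_congr rfl fun z _ => mono_eq_prod_univ S z
  rw [avg_apply, h]
  split_ifs with hS
  · subst hS
    simp
  · obtain ⟨i, hi⟩ := Finset.nonempty_iff_ne_empty.2 hS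
    rw [Finset.prod_eq_zero (Finset.mem_univ i), mul_zero]
    simp [hi, UnitsInt.univ]

theorem avg_mono_mul_mono (S T : Finset (Fin m)) :
    avg m (mono S * mono T) = if S = T then 1 else 0 := by
  rw [mono_mul_mono, avg_mono]
  simp [symmDiff_eq_bot, ← Finset.bot_eq_empty]

theorem degLE_mono {d d' : ℕ} (h : d ≤ d') : degLE m d ≤ degLE m d' :=
  Submodule.span_mono fun _ ⟨S, hS, hf⟩ => ⟨S, hS.trans h, hf⟩

/-- The index set of the monomials of degree at most two. -/
abbrev LowSet (m : ℕ) : Type := {T : Finset (Fin m) // T.card ≤ 2}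

/-- A set of size at most 2 is a union of two optional points. The bound lets the net argument run
with r = n = 2m. -/
theorem card_lowSet_le (m : ℕ) : Fintype.card (LowSet m) ≤ (m + 1) ^ 2 := by
  classical
  let g : Option (Fin m) × Option (Fin m) → LowSet m := fun p =>
    ⟨p.1.toFinset ∪ p.2.toFinset, (Finset.card_union_le _ _).trans (by
      have h : ∀ o : Option (Fin m), o.toFinset.card ≤ 1 := fun o => by cases o <;> simp
      have := h p.1; have := h p.2; omega)⟩
  have hg : Function.Surjective g := by
    rintro ⟨T, hT⟩
    have h3 : T.card = 0 ∨ T.card = 1 ∨ T.card = 2 := by omega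
    rcases h3 with h | h | h
    · exact ⟨(none, none), Subtype.ext (by simp [g, Finset.card_eq_zero.1 h])⟩
    · obtain ⟨i, rfl⟩ := Finset.card_eq_one.1 h
      exact ⟨(some i, none), Subtype.ext (by simp [g])⟩
    · obtain ⟨i, j, -, rfl⟩ := Finset.card_eq_two.1 h
      exact ⟨(some i, some j), Subtype.ext (by ext; simp [g])⟩
  refine (Fintype.card_le_of_surjective g hg).trans (le_of_eq ?_)
  simp [pow_two]

/-- The polynomial of degree at most two with prescribed coefficients. -/
def quadPoly (u : LowSet m → ℝ) : CubeFun m := ∑ T, u T • mono T.1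

theorem exists_quadPoly {q : CubeFun m} (hq : q ∈ degLE m 2) : ∃ u, quadPoly u = q := by
  have h : {f : CubeFun m | ∃ S : Finset (Fin m), S.card ≤ 2 ∧ f = mono S} =
      Set.range fun T : LowSet m => mono T.1 := by
    ext f
    constructor
    · rintro ⟨S, hS, rfl⟩; exact ⟨⟨S, hS⟩, rfl⟩
    · rintro ⟨T, rfl⟩; exact ⟨T.1, T.2, rfl⟩
  rw [degLE, h, Submodule.mem_span_range_iff_exists_fun] at hq
  exact hq

theorem avg_quadPoly_sq (u : LowSet m → ℝ) : avg m (quadPoly u * quadPoly u) = ∑ T, u T ^ 2 := by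
  rw [quadPoly, Finset.sum_mul_sum]
  simp only [map_sum, smul_mul_smul_comm, map_smul, avg_mono_mul_mono, smul_eq_mul]
  refine Finset.sum_congr rfl fun T _ => ?_
  rw [Finset.sum_eq_single T]
  · simp [pow_two]
  · intro T' _ hT
    rw [if_neg (fun h => hT (Subtype.ext h.symm)), mul_zero]
  · simp

/-- The Fourier coefficient at `S` of the product of two polynomials of degree at most two. -/
def prodCoeff (S : Finset (Fin m)) : (LowSet m → ℝ) →ₗ[ℝ] (LowSet m → ℝ) →ₗ[ℝ] ℝ :=
  LinearMap.mk₂ ℝ (fun u v => ∑ T, ∑ T', if symmDiff T.1 T'.1 = S then u T * v T' else 0)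
    (fun u u' v => by
      simp only [Pi.add_apply, add_mul, ← Finset.sum_add_distrib]
      refine Finset.sum_congr rfl fun _ _ => Finset.sum_congr rfl fun _ _ => ?_
      split_ifs <;> simp)
    (fun c u v => by
      simp only [Pi.smul_apply, smul_eq_mul, Finset.mul_sum]
      refine Finset.sum_congr rfl fun _ _ => Finset.sum_congr rfl fun _ _ => ?_
      split_ifs <;> ring)
    (fun u v v' => by
      simp only [Pi.add_apply, mul_add, ← Finset.sum_add_distrib]
      refine Finset.sum_congr rfl fun _ _ => Finset.sum_congr rfl fun _ _ => ?_
      split_ifs <;> simp)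
    (fun c u v => by
      simp only [Pi.smul_apply, smul_eq_mul, Finset.mul_sum]
      refine Finset.sum_congr rfl fun _ _ => Finset.sum_congr rfl fun _ _ => ?_
      split_ifs <;> ring)

theorem prodCoeff_apply (S : Finset (Fin m)) (u v : LowSet m → ℝ) :
    prodCoeff S u v = ∑ T, ∑ T', if symmDiff T.1 T'.1 = S then u T * v T' else 0 := rfl

theorem avg_mono_mul_quadPoly (S : Finset (Fin m)) (u v : LowSet m → ℝ) :
    avg m (mono S * (quadPoly u * quadPoly v)) = prodCoeff S u v := by
  rw [quadPoly, quadPoly, Finset.sum_mul_sum]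
  simp only [Finset.mul_sum, map_sum, smul_mul_smul_comm, mono_mul_mono]
  simp only [mul_smul_comm, map_smul, avg_mono_mul_mono, smul_eq_mul, prodCoeff_apply]
  refine Finset.sum_congr rfl fun _ _ => Finset.sum_congr rfl fun _ _ => ?_
  simp [eq_comm]

/-- For |S| = 4, two sets of size at most 2 with symmetric difference S must partition S, so at most
2⁴ pairs contribute to each S. Cauchy–Schwarz then costs a factor 16, and the fibres over distinct S
are disjoint. -/
theorem sum_prodCoeff_sq_le (u v : LowSet m → ℝ) :
    ∑ S ∈ Finset.powersetCard 4 (Finset.univ : Finset (Fin m)), prodCoeff S u v ^ 2 ≤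
      16 * ((∑ T, u T ^ 2) * ∑ T, v T ^ 2) := by
  classical
  let P : Finset (Fin m) → Finset (LowSet m × LowSet m) := fun S =>
    Finset.univ.filter fun p => symmDiff p.1.1 p.2.1 = S
  have hP : ∀ S, prodCoeff S u v = ∑ p ∈ P S, u p.1 * v p.2 := by
    intro S
    rw [prodCoeff_apply, Finset.sum_filter, Fintype.sum_prod_type]
  have hcard : ∀ S ∈ Finset.powersetCard 4 (Finset.univ : Finset (Fin m)), (P S).card ≤ 16 := by
    intro S hS
    have hS4 : S.card = 4 := (Finset.mem_powersetCard.1 hS).2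
    have h1 : (P S).card ≤ S.powerset.card := by
      refine Finset.card_le_card_of_injOn (fun p => p.1.1) ?_ ?_
      · rintro ⟨⟨T, hT⟩, ⟨T', hT'⟩⟩ hp
        have hp' : symmDiff T T' = S := (Finset.mem_filter.1 hp).2
        rw [Finset.mem_coe, Finset.mem_powerset]
        have h2 : S.card ≤ (T \ T').card + (T' \ T).card := by
          rw [← hp']; exact Finset.card_union_le _ _
        have h3 : (T \ T').card ≤ T.card := Finset.card_le_card Finset.sdiff_subset
        have h4 : (T' \ T).card ≤ T'.card := Finset.card_le_card Finset.sdiff_subset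
        have h5 : T \ T' = T := Finset.eq_of_subset_of_card_le Finset.sdiff_subset (by omega)
        intro i hi
        have hi' : i ∈ T \ T' := by rw [h5]; exact hi
        rw [← hp']
        exact Finset.mem_symmDiff.2 (Or.inl (Finset.mem_sdiff.1 hi'))
      · rintro ⟨⟨T, hT⟩, ⟨T', hT'⟩⟩ hp ⟨⟨U, hU⟩, ⟨U', hU'⟩⟩ hq h
        have hp' : symmDiff T T' = S := (Finset.mem_filter.1 hp).2
        have hq' : symmDiff U U' = S := (Finset.mem_filter.1 hq).2
        have h' : T = U := h
        subst h'
        have : T' = U' := symmDiff_right_injective T (hp'.trans hq'.symm)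
        subst this
        rfl
    rw [Finset.card_powerset, hS4] at h1
    exact h1
  calc _ ≤ ∑ S ∈ Finset.powersetCard 4 (Finset.univ : Finset (Fin m)),
        16 * ∑ p ∈ P S, (u p.1 * v p.2) ^ 2 := by
        refine Finset.sum_le_sum fun S hS => ?_
        rw [hP]
        refine sq_sum_le_card_mul_sum_sq.trans ?_
        have : ((P S).card : ℝ) ≤ 16 := by exact_mod_cast hcard S hS
        exact mul_le_mul_of_nonneg_right this (Finset.sum_nonneg fun _ _ => sq_nonneg _)
    _ ≤ ∑ S : Finset (Fin m), 16 * ∑ p ∈ P S, (u p.1 * v p.2) ^ 2 :=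
        Finset.sum_le_sum_of_subset_of_nonneg (Finset.subset_univ _) fun _ _ _ =>
          mul_nonneg (by norm_num) (Finset.sum_nonneg fun _ _ => sq_nonneg _)
    _ = 16 * ∑ p : LowSet m × LowSet m, (u p.1 * v p.2) ^ 2 := by
        rw [← Finset.mul_sum, Finset.sum_fiberwise]
    _ = _ := by
        rw [Fintype.sum_prod_type, Finset.sum_mul_sum]
        simp_rw [mul_pow]

end Fourier

/-! ### The folded cube and the noise-tilted pseudo-expectation -/

section Folding

variable {n m : ℕ} (e : Fin n ≃ Fin m × ℤˣ)

/-- The sign with which a coordinate appears in the balanced point `fold e z`. -/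
def foldSign (i : Fin n) : ℝ := (((e i).2 : ℤ) : ℝ)

/-- The balanced point of the large cube determined by a point of the small cube: each
coordinate of `z` is used once with each sign. -/
def fold (z : Cube m) : Cube n := fun i => (e i).2 * z (e i).1

theorem coord_fold (i : Fin n) (z : Cube m) :
    coord i (fold e z) = foldSign e i * coord (e i).1 z := by
  simp [coord, fold, foldSign]

theorem foldSign_mul_self (i : Fin n) : foldSign e i * foldSign e i = 1 := by
  rw [foldSign, ← Int.cast_mul, ← Units.val_mul, Int.units_mul_self]; simp

theorem sum_coord_fold (z : Cube m) : ∑ i, coord i (fold e z) = 0 := by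
  simp_rw [coord_fold, foldSign]
  rw [e.sum_comp fun p => ((p.2 : ℤ) : ℝ) * coord p.1 z, Fintype.sum_prod_type]
  refine Finset.sum_eq_zero fun j _ => ?_
  simp [UnitsInt.univ]

theorem mono_comp_fold_mem (T : Finset (Fin n)) : mono T ∘ fold e ∈ degLE m T.card := by
  classical
  induction T using Finset.induction_on with
  | empty => rw [mono_empty]; exact one_mem_degLE _
  | insert i T hi ih =>
    have h : mono (insert i T) ∘ fold e =
        foldSign e i • (coord (e i).1 * (mono T ∘ fold e)) := by
      ext z
      rw [mono, Finset.prod_insert hi]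
      simp only [Function.comp, Pi.mul_apply, Pi.smul_apply, coord_fold, smul_eq_mul, mono]
      ring
    rw [h, Finset.card_insert_of_notMem hi]
    exact Submodule.smul_mem _ _ (coord_mul_mem_degLE _ ih)

theorem comp_fold_mem {d : ℕ} {q : CubeFun n} (hq : q ∈ degLE n d) : q ∘ fold e ∈ degLE m d := by
  induction hq using Submodule.span_induction with
  | mem f hf =>
    obtain ⟨S, hS, rfl⟩ := hf
    exact degLE_mono hS (mono_comp_fold_mem e S)
  | zero => exact Submodule.zero_mem _
  | add f g _ _ hf hg => exact Submodule.add_mem _ hf hg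
  | smul c f _ hf => exact Submodule.smul_mem _ c hf

/-- The support of the monomial obtained by folding the monomial `x_{a 0} x_{a 1} x_{a 2} x_{a 3}`. -/
def foldSupp (a : Fin 4 → Fin n) : Finset (Fin m) :=
  symmDiff (symmDiff {(e (a 0)).1} {(e (a 1)).1}) (symmDiff {(e (a 2)).1} {(e (a 3)).1})

/-- The coefficient at `S` of the folded monomial `x_{a 0} x_{a 1} x_{a 2} x_{a 3}`. -/
def foldCoeff (S : Finset (Fin m)) (a : Fin 4 → Fin n) : ℝ :=
  if foldSupp e a = S then ∏ k, foldSign e (a k) else 0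

theorem prod_foldSign_sq (a : Fin 4 → Fin n) : (∏ k, foldSign e (a k)) ^ 2 = 1 := by
  rw [← Finset.prod_pow]
  exact Finset.prod_eq_one fun k _ => by rw [pow_two, foldSign_mul_self]

theorem tensorPow_comp_fold (a : Fin 4 → Fin n) :
    (fun x => tensorPow x a) ∘ fold e = (∏ k, foldSign e (a k)) • mono (foldSupp e a) := by
  rw [foldSupp, ← mono_mul_mono, ← mono_mul_mono, ← mono_mul_mono]
  simp only [mono_singleton]
  ext z
  simp only [Function.comp, tensorPow, coord_fold, Finset.prod_mul_distrib, Pi.smul_apply,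
    Pi.mul_apply, smul_eq_mul]
  congr 1
  rw [Fin.prod_univ_four]; ring

/-- All four indices must lie over S, which has 8 preimages, whence 8⁴ = 4096. -/
theorem card_foldSupp_fiber_le {S : Finset (Fin m)} (hS : S.card = 4) :
    (Finset.univ.filter fun a : Fin 4 → Fin n => foldSupp e a = S).card ≤ 4096 := by
  classical
  let B : Finset (Fin n) := (S ×ˢ Finset.univ).map e.symm.toEmbedding
  have hB : B.card = 8 := by
    rw [Finset.card_map, Finset.card_product, hS]; rfl
  have hsub : (Finset.univ.filter fun a : Fin 4 → Fin n => foldSupp e a = S) ⊆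
      Fintype.piFinset fun _ => B := by
    intro a ha
    have ha' : foldSupp e a = S := (Finset.mem_filter.1 ha).2
    have h1 : foldSupp e a ⊆ Finset.univ.image fun k => (e (a k)).1 := by
      intro j hj
      simp only [foldSupp, Finset.mem_symmDiff, Finset.mem_singleton] at hj
      rw [Finset.mem_image]
      by_contra hne
      simp only [not_exists, not_and, Finset.mem_univ, true_implies] at hne
      have h0 := hne 0
      have h1 := hne 1
      have h2 := hne 2
      have h3 := hne 3
      grind
    have h2 : foldSupp e a = Finset.univ.image fun k => (e (a k)).1 :=
      Finset.eq_of_subset_of_card_le h1 (by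
        rw [ha', hS]; exact Finset.card_image_le.trans (by simp))
    rw [Fintype.mem_piFinset]
    intro k
    rw [Finset.mem_map_equiv, Equiv.symm_symm, Finset.mem_product, ← ha', h2]
    exact ⟨Finset.mem_image_of_mem _ (Finset.mem_univ k), Finset.mem_univ _⟩
  refine (Finset.card_le_card hsub).trans ?_
  simp [hB]

theorem exists_foldSupp_eq {S : Finset (Fin m)} (hS : S.card = 4) : ∃ a, foldSupp e a = S := by
  obtain ⟨i, T, hi, rfl, hT⟩ := Finset.card_eq_succ.1 hS
  obtain ⟨j, k, l, hjk, hjl, hkl, rfl⟩ := Finset.card_eq_three.1 hT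
  refine ⟨![e.symm (i, 1), e.symm (j, 1), e.symm (k, 1), e.symm (l, 1)], ?_⟩
  simp only [Finset.mem_insert, Finset.mem_singleton, not_or] at hi
  obtain ⟨hij, hik, hil⟩ := hi
  ext x
  simp [foldSupp, Finset.mem_symmDiff]
  grind

theorem one_le_sum_foldCoeff_sq {S : Finset (Fin m)} (hS : S.card = 4) :
    1 ≤ ∑ a, foldCoeff e S a ^ 2 := by
  obtain ⟨a, ha⟩ := exists_foldSupp_eq e hS
  refine le_trans (le_of_eq ?_) (Finset.single_le_sum (f := fun a => foldCoeff e S a ^ 2)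
    (fun _ _ => sq_nonneg _) (Finset.mem_univ a))
  simp only [foldCoeff, if_pos ha, prod_foldSign_sq]

theorem foldCoeff_disjoint {S S' : Finset (Fin m)} (h : S ≠ S') (a : Fin 4 → Fin n) :
    foldCoeff e S a = 0 ∨ foldCoeff e S' a = 0 := by
  by_cases hS : foldSupp e a = S
  · exact Or.inr (if_neg fun h' => h (hS.symm.trans h'))
  · exact Or.inl (if_neg hS)

theorem abs_foldCoeff_le (S : Finset (Fin m)) (a : Fin 4 → Fin n) : |foldCoeff e S a| ≤ 1 := by
  rw [foldCoeff]
  split_ifs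
  · rw [← sq_le_one_iff_abs_le_one, prod_foldSign_sq]
  · simp

/-- Each tensor entry folds to a single monomial, so the inner sum has at most one nonzero term and
there are no cross terms. -/
theorem sum_sum_foldCoeff_mul_sq_le (β : Finset (Fin m) → ℝ) :
    ∑ a, (∑ S ∈ Finset.powersetCard 4 (Finset.univ : Finset (Fin m)), foldCoeff e S a * β S) ^ 2 ≤
      4096 * ∑ S ∈ Finset.powersetCard 4 (Finset.univ : Finset (Fin m)), β S ^ 2 := by
  classical
  have h1 : ∀ a, (∑ S ∈ Finset.powersetCard 4 (Finset.univ : Finset (Fin m)),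
      foldCoeff e S a * β S) ^ 2 = ∑ S ∈ Finset.powersetCard 4 (Finset.univ : Finset (Fin m)),
      if foldSupp e a = S then β S ^ 2 else 0 := by
    intro a
    simp only [foldCoeff, ite_mul, zero_mul]
    rw [Finset.sum_ite_eq, Finset.sum_ite_eq]
    split_ifs
    · rw [mul_pow, prod_foldSign_sq, one_mul]
    · simp
  simp_rw [h1]
  rw [Finset.sum_comm, Finset.mul_sum]
  refine Finset.sum_le_sum fun S hS => ?_
  rw [← Finset.sum_filter, Finset.sum_const, nsmul_eq_mul]
  have : ((Finset.univ.filter fun a : Fin 4 → Fin n => foldSupp e a = S).card : ℝ) ≤ 4096 := by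
    exact_mod_cast card_foldSupp_fiber_le e (Finset.mem_powersetCard.1 hS).2
  exact mul_le_mul_of_nonneg_right this (sq_nonneg _)

/-- The degree-four Fourier coefficient at `S` of the folded noise polynomial. -/
def noiseCoeff (W : Tensor n) (S : Finset (Fin m)) : ℝ := ∑ a, foldCoeff e S a * W a

/-- The density, relative to the uniform distribution on the folded cube, of the
pseudo-distribution correlated with the noise. -/
def noiseDensity (γ : ℝ) (W : Tensor n) : CubeFun m :=
  1 + γ • ∑ S ∈ Finset.powersetCard 4 (Finset.univ : Finset (Fin m)), noiseCoeff e W S • mono S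

/-- The pseudo-expectation correlated with the noise. -/
noncomputable def noiseExp (γ : ℝ) (W : Tensor n) : CubeFun n →ₗ[ℝ] ℝ :=
  avg m ∘ₗ LinearMap.mulLeft ℝ (noiseDensity e γ W) ∘ₗ LinearMap.funLeft ℝ ℝ (fold e)

theorem noiseExp_apply (γ : ℝ) (W : Tensor n) (f : CubeFun n) :
    noiseExp e γ W f = avg m (f ∘ fold e) +
      γ * ∑ S ∈ Finset.powersetCard 4 (Finset.univ : Finset (Fin m)),
        noiseCoeff e W S * avg m (mono S * (f ∘ fold e)) := by
  change avg m (noiseDensity e γ W * (f ∘ fold e)) = _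
  rw [noiseDensity, add_mul, one_mul, map_add, smul_mul_assoc, map_smul, Finset.sum_mul, map_sum]
  simp only [smul_mul_assoc, map_smul, smul_eq_mul]

theorem ne_empty_of_mem_powersetCard_four {S : Finset (Fin m)}
    (hS : S ∈ Finset.powersetCard 4 (Finset.univ : Finset (Fin m))) : S ≠ ∅ := by
  rintro rfl
  simpa using (Finset.mem_powersetCard.1 hS).2

theorem noiseExp_one (γ : ℝ) (W : Tensor n) : noiseExp e γ W 1 = 1 := by
  rw [noiseExp_apply, show (1 : CubeFun n) ∘ fold e = mono ∅ from mono_empty.symm, avg_mono,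
    if_pos rfl, Finset.sum_eq_zero, mul_zero, add_zero]
  intro S hS
  rw [avg_mono_mul_mono, if_neg (ne_empty_of_mem_powersetCard_four hS), mul_zero]

theorem noiseExp_satisfiesEq (γ : ℝ) (W : Tensor n) (d : ℕ) :
    SatisfiesEq d (noiseExp e γ W) (∑ i, coord i) := by
  intro q _
  have h : ((∑ i, coord i) * q) ∘ fold e = 0 := by
    ext z
    simp [Finset.sum_apply, sum_coord_fold]
  rw [noiseExp_apply, h]
  simp

/-- The quadratic form of the noise on polynomials of degree at most two, one tensor entry at a
time. -/
noncomputable def foldForm (a : Fin 4 → Fin n) :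
    (LowSet m → ℝ) →ₗ[ℝ] (LowSet m → ℝ) →ₗ[ℝ] ℝ :=
  ∑ S ∈ Finset.powersetCard 4 (Finset.univ : Finset (Fin m)), foldCoeff e S a • prodCoeff S

theorem foldForm_apply (a : Fin 4 → Fin n) (u v : LowSet m → ℝ) :
    foldForm e a u v = ∑ S ∈ Finset.powersetCard 4 (Finset.univ : Finset (Fin m)),
      foldCoeff e S a * prodCoeff S u v := by
  simp [foldForm]

/-- The constant is 4096 · 16 = 256²: fibre size of the folding times the multiplicity in
`prodCoeff`. -/
theorem sum_foldForm_sq_le (u v : LowSet m → ℝ) :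
    ∑ a, foldForm e a u v ^ 2 ≤ 256 ^ 2 * ((∑ T, u T ^ 2) * ∑ T, v T ^ 2) := by
  simp_rw [foldForm_apply]
  have h1 := sum_sum_foldCoeff_mul_sq_le e fun S => prodCoeff S u v
  have h2 := sum_prodCoeff_sq_le u v
  linarith

/-- By Parseval the uniform part of E[q²] is |u|², with u the coefficients of the folded q. The tilt
changes it by at most γ K |u|². -/
theorem noiseExp_feasible {γ : ℝ} (hγ : 0 ≤ γ) (W : Tensor n) {K : ℝ} (hK : γ * K ≤ 1)
    (hW : ∀ u, |∑ a, foldForm e a u u * W a| ≤ K * ∑ T, u T ^ 2) :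
    noiseExp e γ W ∈ feasible n := by
  refine ⟨⟨noiseExp_one e γ W, fun q hq => ?_⟩, noiseExp_satisfiesEq e γ W 4⟩
  obtain ⟨u, hu⟩ := exists_quadPoly (comp_fold_mem e hq)
  have h1 : (q * q) ∘ fold e = quadPoly u * quadPoly u := by rw [hu]; rfl
  rw [noiseExp_apply, h1, avg_quadPoly_sq]
  simp_rw [avg_mono_mul_quadPoly]
  have h2 : ∑ S ∈ Finset.powersetCard 4 (Finset.univ : Finset (Fin m)),
      noiseCoeff e W S * prodCoeff S u u = ∑ a, foldForm e a u u * W a := by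
    simp_rw [foldForm_apply, noiseCoeff, Finset.sum_mul]
    rw [Finset.sum_comm]
    refine Finset.sum_congr rfl fun _ _ => Finset.sum_congr rfl fun _ _ => by ring
  rw [h2]
  have h3 := mul_le_mul_of_nonneg_left (neg_le_of_abs_le (hW u)) hγ
  have h4 : 0 ≤ ∑ T, u T ^ 2 := Finset.sum_nonneg fun _ _ => sq_nonneg _
  nlinarith [mul_le_mul_of_nonneg_right hK h4]

theorem noiseExp_tensorPow (γ : ℝ) (W : Tensor n) (a : Fin 4 → Fin n) :
    noiseExp e γ W (fun x => tensorPow x a) = foldCoeff e ∅ a +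
      γ * ∑ S ∈ Finset.powersetCard 4 (Finset.univ : Finset (Fin m)),
        noiseCoeff e W S * foldCoeff e S a := by
  rw [noiseExp_apply, tensorPow_comp_fold]
  simp only [mul_smul_comm, map_smul, avg_mono, avg_mono_mul_mono, smul_eq_mul, foldCoeff]
  simp [eq_comm]

theorem objective_eq_sum (T : Tensor n) :
    objective T = ∑ a, T a • (fun x => tensorPow x a : CubeFun n) := by
  ext x; simp [objective, Finset.sum_apply]

/-- Under the tilt each degree-4 coefficient of the folded noise is paired with γ times itself, so
the gain is a sum of squares. -/
theorem noiseExp_objective_noise (γ : ℝ) (W : Tensor n) :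
    noiseExp e γ W (objective W) = noiseCoeff e W ∅ +
      γ * ∑ S ∈ Finset.powersetCard 4 (Finset.univ : Finset (Fin m)), noiseCoeff e W S ^ 2 := by
  rw [objective_eq_sum]
  simp only [map_sum, map_smul, smul_eq_mul, noiseExp_tensorPow, mul_add,
    Finset.sum_add_distrib]
  congr 1
  · rw [noiseCoeff]
    exact Finset.sum_congr rfl fun _ _ => mul_comm _ _
  · simp only [Finset.mul_sum]
    rw [Finset.sum_comm]
    refine Finset.sum_congr rfl fun S _ => ?_
    rw [pow_two]
    nth_rewrite 3 [noiseCoeff]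
    rw [Finset.mul_sum, Finset.mul_sum]
    exact Finset.sum_congr rfl fun _ _ => by ring

end Folding

/-! ### The signal polynomial -/

theorem objective_tensorPow {n : ℕ} (y : Cube n) :
    objective (tensorPow y) =
      (∑ i, coord i y • coord i) ^ 2 * (∑ i, coord i y • coord i) ^ 2 := by
  ext x
  rw [← pow_add]
  simp only [Pi.pow_apply, Finset.sum_apply, Pi.smul_apply, smul_eq_mul]
  rw [Fintype.sum_pow, objective]
  simp [tensorPow, Finset.prod_mul_distrib]

/-- The signal is the square of the quadratic ⟨y, x⟩², so it never counts against the competitor. -/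
theorem map_objective_tensorPow_nonneg {n : ℕ} (y : Cube n) {E : CubeFun n →ₗ[ℝ] ℝ}
    (hE : IsPseudoExpectation 2 E) : 0 ≤ E (objective (tensorPow y)) := by
  rw [objective_tensorPow]
  refine hE.sq_nonneg _ ?_
  rw [pow_two, Finset.sum_mul_sum]
  refine Submodule.sum_mem _ fun i _ => Submodule.sum_mem _ fun j _ => ?_
  rw [smul_mul_smul_comm]
  exact Submodule.smul_mem _ _ (coord_mul_coord_mem_degLE i j)

theorem objective_spiked {n : ℕ} (y : Cube n) (σ : ℝ) (W : Tensor n) :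
    objective (spiked y σ W) = objective (tensorPow y) + σ • objective W := by
  ext x
  simp only [objective, spiked, Pi.add_apply, Pi.smul_apply, smul_eq_mul, add_mul,
    Finset.sum_add_distrib, Finset.mul_sum, mul_assoc]

theorem objective_tensorPow_self {n : ℕ} (y : Cube n) : objective (tensorPow y) y = (n : ℝ) ^ 4 := by
  rw [objective_tensorPow]
  simp only [Pi.mul_apply, Pi.pow_apply, Finset.sum_apply, Pi.smul_apply, smul_eq_mul,
    coord_mul_self_apply]
  simp
  ring

/-! ### Failure above the threshold -/

section Failure

variable {n m : ℕ}

theorem noiseExp_beats (e : Fin n ≃ Fin m × ℤˣ) (y : Cube n) {σ γ B : ℝ} (W : Tensor n)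
    (hfeas : noiseExp e γ W ∈ feasible n) (hσ : 0 ≤ σ)
    (hB : B ≤ γ * ∑ S ∈ Finset.powersetCard 4 (Finset.univ : Finset (Fin m)),
      noiseCoeff e W S ^ 2)
    (hlin : ∑ a, (tensorPow y a - foldCoeff e ∅ a) * W a ≤ B / 2)
    (hgap : (n : ℝ) ^ 4 < σ * (B / 2)) :
    ∃ E ∈ feasible n, objective (spiked y σ W) y < E (objective (spiked y σ W)) := by
  refine ⟨_, hfeas, ?_⟩
  have h1 := map_objective_tensorPow_nonneg y hfeas.1
  rw [objective_spiked, map_add, map_smul, noiseExp_objective_noise, Pi.add_apply, Pi.smul_apply,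
    objective_tensorPow_self, smul_eq_mul, smul_eq_mul]
  -- The constant coefficient of the folded noise occurs in both values and cancels, leaving one
  -- linear form in W to control.
  have h2 : objective W y = ∑ a, (tensorPow y a - foldCoeff e ∅ a) * W a + noiseCoeff e W ∅ := by
    rw [objective, noiseCoeff, ← Finset.sum_add_distrib]
    exact Finset.sum_congr rfl fun _ _ => by ring
  rw [h2]
  have h3 := mul_le_mul_of_nonneg_left hB hσ
  have h4 := mul_le_mul_of_nonneg_left hlin hσ
  linarith

theorem even_of_sum_coord_eq_zero (y : Cube n) (hy : ∑ i, coord i y = 0) : Even n := by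
  have h1 : ∑ i, (y i : ℤ) = 0 := by
    have : ((∑ i, (y i : ℤ) : ℤ) : ℝ) = 0 := by
      push_cast; exact hy
    exact_mod_cast this
  have h2 : ∀ u : ℤˣ, ((u : ℤ) : ZMod 2) = 1 := by decide
  have h3 : ((∑ i, (y i : ℤ) : ℤ) : ZMod 2) = 0 := by rw [h1]; simp
  push_cast at h3
  simp only [h2, Finset.sum_const, Finset.card_univ, Fintype.card_fin, nsmul_eq_mul, mul_one] at h3
  exact (ZMod.natCast_eq_zero_iff_even).1 h3

/-- For m ≥ 6 one has m - 3 ≥ m / 2, and 6144 = 2⁴ · 2⁴ · 4!. -/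
theorem pow_four_le_choose (hm : 6 ≤ m) : ((2 * m : ℕ) : ℝ) ^ 4 / 6144 ≤ (m.choose 4 : ℝ) := by
  have h := Nat.pow_le_choose (α := ℝ) 4 m
  refine le_trans ?_ h
  have h1 : (m : ℝ) / 2 ≤ ((m + 1 - 4 : ℕ) : ℝ) := by
    rw [Nat.cast_sub (by omega)]
    have : (6 : ℝ) ≤ m := by exact_mod_cast hm
    push_cast; linarith
  have h2 : ((m : ℝ) / 2) ^ 4 ≤ ((m + 1 - 4 : ℕ) : ℝ) ^ 4 := by gcongr
  have h3 : (Nat.factorial 4 : ℝ) = 24 := by norm_num [Nat.factorial]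
  rw [h3]
  push_cast
  have h4 : (2 * (m : ℝ)) ^ 4 / 6144 = (m / 2) ^ 4 / 24 := by ring
  rw [h4]
  gcongr
  exact_mod_cast h1

/-- The coefficients are at most 2 in absolute value, so the standard deviation is at most 2n², far
below the gain of order n³. -/
theorem tensorPow_sub_foldCoeff_tail (e : Fin n ≃ Fin m × ℤˣ) (hn : 0 < n) (y : Cube n) {κ : ℝ}
    (hκ : 0 < κ) :
    gaussianTensor n {W | κ * (n : ℝ) ^ 3 / 2 ≤ ∑ a, (tensorPow y a - foldCoeff e ∅ a) * W a} ≤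
      ENNReal.ofReal (32 / κ ^ 2 / n) := by
  have hnR : (1 : ℝ) ≤ n := by exact_mod_cast hn
  refine (linear_tail (fun a => tensorPow y a - foldCoeff e ∅ a) (v := 4 * (n : ℝ) ^ 4)
    (by positivity) ?_ (by positivity)).trans (ENNReal.ofReal_le_ofReal ?_)
  · calc _ ≤ ∑ _a : Fin 4 → Fin n, (4 : ℝ) := by
          refine Finset.sum_le_sum fun a _ => ?_
          have h1 : |tensorPow y a| ≤ 1 := by
            rw [← sq_le_one_iff_abs_le_one, tensorPow, ← Finset.prod_pow]
            exact (Finset.prod_eq_one fun k _ => by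
              rw [pow_two, coord_mul_self_apply]).le
          have h2 := abs_foldCoeff_le e ∅ a
          rw [abs_le] at h1 h2
          nlinarith
      _ = _ := by simp [mul_comm]
  · have hx : -(κ * (n : ℝ) ^ 3 / 2) ^ 2 / (2 * (4 * (n : ℝ) ^ 4)) = -(κ ^ 2 * n ^ 2 / 32) := by
      field_simp; norm_num
    rw [hx, Real.exp_neg]
    calc _ ≤ (κ ^ 2 * (n : ℝ) ^ 2 / 32)⁻¹ :=
          inv_anti₀ (by positivity) (by linarith [Real.add_one_le_exp (κ ^ 2 * (n : ℝ) ^ 2 / 32)])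
      _ = 32 / κ ^ 2 / n ^ 2 := by field_simp
      _ ≤ 32 / κ ^ 2 / n := by
        gcongr
        nlinarith

/-- For noise of order `n`, up to a large constant, the relaxation does not recover `y`. -/
theorem exists_not_beaten_le : ∃ A K : ℝ, 0 < A ∧ 0 < K ∧ ∀ n : ℕ, 12 ≤ n →
    ∀ y : Cube n, ∑ i, coord i y = 0 → ∀ σ : ℝ, A * n < σ →
      gaussianTensor n {W | ¬ ∃ E ∈ feasible n,
        objective (spiked y σ W) y < E (objective (spiked y σ W))} ≤ ENNReal.ofReal (K / n) := by
  -- The gain is at least κ n³: 4096 = 16 · 256 is the norm constant behind γ, 16 comes from the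
  -- lower bound on the sum of squares, and 6144 from the number of 4-sets. The equation is kept
  -- opaque so that κ is not unfolded.
  obtain ⟨κ, hκ⟩ : ∃ κ : ℝ, κ = 1 / (4096 * 16 * 6144) := ⟨_, rfl⟩
  have hκ0 : 0 < κ := by rw [hκ]; norm_num
  refine ⟨2 / κ, 1 + 16 * 6144 + 32 / κ ^ 2, by positivity, by positivity,
    fun n hn y hy σ hσ => ?_⟩
  obtain ⟨m, hm⟩ := even_of_sum_coord_eq_zero y hy
  have hnm : n = 2 * m := by omega
  have hn0 : 0 < n := by omega
  have hnR : (12 : ℝ) ≤ n := by exact_mod_cast hn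
  -- Any bijection will do: the folding need not be related to y.
  let e : Fin n ≃ Fin m × ℤˣ := Fintype.equivOfCardEq (by
    rw [Fintype.card_fin, Fintype.card_prod, Fintype.card_fin, Fintype.card_units_int]; omega)
  set P := Finset.powersetCard 4 (Finset.univ : Finset (Fin m)) with hP
  have hPcard : (n : ℝ) ^ 4 / 6144 ≤ P.card := by
    rw [hP, Finset.card_powersetCard, Finset.card_univ, Fintype.card_fin, hnm]
    exact pow_four_le_choose (by omega)
  have hP0 : (0 : ℝ) < P.card := lt_of_lt_of_le (by positivity) hPcard
  have hPne : P.Nonempty := Finset.card_pos.1 (by exact_mod_cast hP0)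
  have hσ0 : 0 ≤ σ := le_trans (by positivity) hσ.le
  have hsub : {W | ¬ ∃ E ∈ feasible n,
        objective (spiked y σ W) y < E (objective (spiked y σ W))} ⊆
      ({W | ¬ ∀ u, |∑ a, foldForm e a u u * W a| ≤ 16 * 256 * n * ∑ T, u T ^ 2} ∪
        {W | ∑ S ∈ P, (∑ a, foldCoeff e S a * W a) ^ 2 ≤ P.card / 16}) ∪
      {W | κ * (n : ℝ) ^ 3 / 2 ≤ ∑ a, (tensorPow y a - foldCoeff e ∅ a) * W a} := by
    intro W hW
    by_contra h
    simp only [Set.mem_union, Set.mem_ofPred_eq, not_or, not_not, not_le] at h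
    obtain ⟨⟨h1, h2⟩, h3⟩ := h
    refine hW (noiseExp_beats e y (γ := 1 / (4096 * n)) (B := κ * (n : ℝ) ^ 3) W ?_ hσ0 ?_
      h3.le ?_)
    · refine noiseExp_feasible e (by positivity) W (K := 16 * 256 * n) ?_ h1
      rw [show (16 * 256 * (n : ℝ)) = 4096 * n by norm_num, one_div,
        inv_mul_cancel₀ (by positivity)]
    · calc κ * (n : ℝ) ^ 3 = 1 / (4096 * n) * ((n : ℝ) ^ 4 / 6144 / 16) := by
            rw [hκ]; field_simp
        _ ≤ _ := by
            gcongr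
            exact (div_le_div_of_nonneg_right hPcard (by norm_num)).trans h2.le
    · calc (n : ℝ) ^ 4 = 2 / κ * n * (κ * (n : ℝ) ^ 3 / 2) := by field_simp
        _ < _ := by gcongr
  have hA := gaussian_bilin_bound (foldForm e) hn0 ((card_lowSet_le m).trans
    (Nat.pow_le_pow_left (by omega) 2)) (s := 256) (by norm_num) (sum_foldForm_sq_le e)
  have hBd := sum_sq_linear_lower P (foldCoeff e)
    (fun S hS => one_le_sum_foldCoeff_sq e (Finset.mem_powersetCard.1 hS).2)
    (fun S _ S' _ h a => foldCoeff_disjoint e h a) hPne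
  refine (measure_mono hsub).trans ((measure_union_le _ _).trans ?_)
  refine (add_le_add ((measure_union_le _ _).trans (add_le_add hA hBd))
    (tensorPow_sub_foldCoeff_tail e hn0 y hκ0)).trans ?_
  rw [← ENNReal.ofReal_add (by positivity) (by positivity),
    ← ENNReal.ofReal_add (by positivity) (by positivity)]
  refine ENNReal.ofReal_le_ofReal ?_
  rw [add_div, add_div]
  gcongr ?_ + ?_ + _
  · rw [Real.exp_neg, one_div]
    refine inv_anti₀ (by positivity) ?_
    nlinarith [Real.add_one_le_exp ((n : ℝ) ^ 2)]
  · calc (16 : ℝ) / P.card ≤ 16 / ((n : ℝ) ^ 4 / 6144) := by gcongr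
      _ = 16 * 6144 / (n : ℝ) ^ 4 := by field_simp
      _ ≤ 16 * 6144 / n := by
        gcongr
        exact le_self_pow₀ (by linarith) (by norm_num)

theorem failure_above_threshold : ∀ c : ℝ, 0 < c → ∀ δ : ℝ, 0 < δ → ∀ᶠ n : ℕ in atTop,
    ∀ y : Cube n, ∑ i, coord i y = 0 →
    ∀ σ : ℝ, n * Real.log n ^ (1 / 2 + c) ≤ σ →
      gaussianTensor n {W | ¬ ∃ E ∈ feasible n,
        objective (spiked y σ W) y < E (objective (spiked y σ W))} ≤ ENNReal.ofReal δ := by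
  intro c hc δ hδ
  obtain ⟨A, K, hA, hK, h⟩ := exists_not_beaten_le
  -- Only divergence is needed, since noise above A n already defeats the relaxation.
  have hlim : Tendsto (fun n : ℕ => Real.log n ^ (1 / 2 + c)) atTop atTop :=
    (tendsto_rpow_atTop (by positivity)).comp
      (Real.tendsto_log_atTop.comp tendsto_natCast_atTop_atTop)
  filter_upwards [eventually_ge_atTop 12, eventually_ge_atTop ⌈K / δ⌉₊,
    hlim.eventually_gt_atTop A] with n hn hnδ hlog y hy σ hσ
  have hn0 : (0 : ℝ) < n := by exact_mod_cast (show 0 < n by omega)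
  refine (h n hn y hy σ (lt_of_lt_of_le ?_ hσ)).trans (ENNReal.ofReal_le_ofReal ?_)
  · rw [mul_comm]
    exact mul_lt_mul_of_pos_left hlog hn0
  · have := Nat.ceil_le.1 hnδ
    rw [div_le_iff₀ hδ] at this
    rw [div_le_iff₀ hn0]
    linarith

end Failure

end SpikedTensor

theorem mainTheorem4 :
    (∃ C : ℝ, 0 < C ∧ ∀ δ : ℝ, 0 < δ → ∀ᶠ n : ℕ in atTop,
      ∀ y : SpikedTensor.Cube n, ∑ i, SpikedTensor.coord i y = 0 →
      ∀ σ : ℝ, 0 ≤ σ → σ ≤ C * (n / Real.sqrt (Real.log n)) →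
        SpikedTensor.gaussianTensor n
          {W | ¬ SpikedTensor.Recovers
            (SpikedTensor.objective (SpikedTensor.spiked y σ W)) y} ≤ ENNReal.ofReal δ) ∧
    (∀ c : ℝ, 0 < c → ∀ δ : ℝ, 0 < δ → ∀ᶠ n : ℕ in atTop,
      ∀ y : SpikedTensor.Cube n, ∑ i, SpikedTensor.coord i y = 0 →
      ∀ σ : ℝ, n * Real.log n ^ (1 / 2 + c) ≤ σ →
        SpikedTensor.gaussianTensor n
          {W | ¬ ∃ E ∈ SpikedTensor.feasible n,
            SpikedTensor.objective (SpikedTensor.spiked y σ W) y <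
              E (SpikedTensor.objective (SpikedTensor.spiked y σ W))} ≤ ENNReal.ofReal δ) := by
  exact ⟨SpikedTensor.recovery_below_threshold, SpikedTensor.failure_above_threshold⟩
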